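/- Let $n\ge 2$. For $g\in\mathrm{SU}(n)$ let $\phi(g)$ be the unitary that $g$ induces on $\bigoplus_{k=0}^n\bigwedge^k\mathbb C^n\cong(\mathbb C^2)^{\otimes n}$, where the bit string $|s\rangle$ corresponds to $\bigwedge_{s_i=1}e_i$ (factors in increasing order); $\phi$ is the quantum compound ansatz on $n$ qubits for $\mathrm{SU}(n)$, and its restriction to $\mathrm{SO}(n)$ is the one for $\mathrm{SO}(n)$. The generators are $H=d\phi(h)$ with $h=-\tfrac i2X^{(ij)}$, $-\tfrac i2Y^{(ij)}$ or $-\tfrac i2Z^{(ij)}$ for $i\ne j$ (for $\mathrm{SO}(n)$ only $h=-\tfrac i2Y^{(ij)}$), where $X^{(ij)},Y^{(ij)},Z^{(ij)}$ are the Pauli matrices on the $2\times2$ block of $i,j$ and zero elsewhere. For the compact group $G=\mathrm{SU}(n)$ or $G=\mathrm{SO}(n)$ with Haar probability measure $\mu$, $h$ in its Lie algebra $\mathfrak g$, $H=d\phi(h)$, an observable $O$ and a state $\rho$ put $$\mathrm{GradVar}=\operatorname{Var}_{(g^+,g^-)\sim\mu\otimes\mu}\,\mathrm{Tr}\Big(\phi(g^-)^\dagger\rho\,\phi(g^-)\,\big[H,\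 \phi(g^+)\,O\,\phi(g^+)^\dagger\big]\Big).$$ For each of the two groups, $i\sigma^z_j$ is not in the dynamical Lie algebra (the real Lie algebra generated by the operators $d\phi(h)$, $h$ a generator), for every qubit $j$. Nevertheless there are a constant $C>0$ and an exponent $d\in\mathbb N$ such that the following holds for every $n\ge2$, for both groups, and for every initial state $\rho=|\psi\rangle\langle\psi|$ where $|\psi\rangle$ is either a computational basis state other than $|0\cdots0\rangle$ and $|1\cdots1\rangle$, or the uniform superposition of all computational basis states. 1. If $O=\sigma^z_j$ for some qubit $j$ and $H$ is one of the generators, then $\mathrm{GradVar}\ge C/n^d$; that is, $\mathrm{GradVar}\in\Omega(1/\mathrm{poly}(n))$. 2. If, more generally, $O=\sum_{j=1}^n c_j\sigma^z_j$ with real $c_j$, and $H=d\phi(h)$ with any $h\in\mathfrak g$, then $$\mathrm{GradVar}\ \ge\ \frac C{n^d}\,\|h\|_{\mathfrak g}^2\,\sum_{j=1}^n(c_j-\bar c)^2,\qquad \|h\|_{\mathfrak g}^2=-\mathrm{Tr}(h^2),\quad \bar c=\frac1n\sum_{j=1}^n c_j .$$ -/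

import Mathlib

open MeasureTheory

/-- Labels of the computational basis of `n` qubits: bit strings of length `n`. -/
abbrev Qubits (n : ℕ) : Type := Fin n → Fin 2

/-- The qubits that are in the state `1` in a bit string. -/
def occupied {n : ℕ} (s : Qubits n) : Finset (Fin n) :=
  Finset.univ.filter fun i => s i = 1

/-- The matrix, in the basis of bit strings `|s⟩ = ⋀_{s i = 1} e_i` (factors in increasing order),
of the map induced by `g` on the exterior algebra `⨁ₖ ⋀ᵏ ℂⁿ`, the state space of `n` qubits:
the entry at `(s, t)` is the minor of `g` with rows `occupied s` and columns `occupied t` if both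
have the same number of elements (the same Hamming weight), and `0` otherwise. -/
noncomputable def compoundMatrix {n : ℕ} (g : Matrix (Fin n) (Fin n) ℂ) :
    Matrix (Qubits n) (Qubits n) ℂ :=
  Matrix.of fun s t =>
    if h : (occupied t).card = (occupied s).card then
      (g.submatrix ((occupied s).orderEmbOfFin rfl) ((occupied t).orderEmbOfFin h)).det
    else 0

/-- The differential of `compoundMatrix` at the identity: the derivative at `τ = 0` of
`compoundMatrix (exp (τ h))`, entry by entry. -/
noncomputable def compoundDifferential {n : ℕ} (h : Matrix (Fin n) (Fin n) ℂ) :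
    Matrix (Qubits n) (Qubits n) ℂ :=
  Matrix.of fun s t =>
    deriv (fun τ : ℝ => compoundMatrix (NormedSpace.exp (τ • h)) s t) 0

section Groups

variable {n : ℕ} {𝕜 : Type*} [RCLike 𝕜]

/-- The Borel sigma-algebra of `SU(n)` (for `𝕜 = ℂ`) and of `SO(n)` (for `𝕜 = ℝ`). -/
instance instMeasurableSpaceSU :
    MeasurableSpace (Matrix.specialUnitaryGroup (Fin n) 𝕜) := borel _

instance instBorelSpaceSU : BorelSpace (Matrix.specialUnitaryGroup (Fin n) 𝕜) := ⟨rfl⟩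

instance instIsTopologicalGroupSU :
    IsTopologicalGroup (Matrix.specialUnitaryGroup (Fin n) 𝕜) where
  continuous_inv := by
    refine Continuous.subtype_mk ?_ _
    exact continuous_subtype_val.star

theorem norm_entry_le_one {A : Matrix (Fin n) (Fin n) 𝕜}
    (hA : A ∈ Matrix.specialUnitaryGroup (Fin n) 𝕜) (i j : Fin n) : ‖A i j‖ ≤ 1 :=
  entry_norm_bound_of_unitary (Matrix.mem_specialUnitaryGroup_iff.1 hA).1 i j

instance instCompactSpaceSU : CompactSpace (Matrix.specialUnitaryGroup (Fin n) 𝕜) := by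
  suffices h : IsCompact
      (Matrix.specialUnitaryGroup (Fin n) 𝕜 : Set (Matrix (Fin n) (Fin n) 𝕜)) from
    isCompact_iff_compactSpace.1 h
  have hK : IsCompact (Set.pi Set.univ fun _ : Fin n => Set.pi Set.univ fun _ : Fin n =>
      Metric.closedBall (0 : 𝕜) 1) :=
    isCompact_univ_pi fun _ => isCompact_univ_pi fun _ => isCompact_closedBall _ _
  refine IsCompact.of_isClosed_subset (s := Set.pi Set.univ fun _ : Fin n =>
    Set.pi Set.univ fun _ : Fin n => Metric.closedBall (0 : 𝕜) 1) hK ?_ ?_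
  · have : (Matrix.specialUnitaryGroup (Fin n) 𝕜 : Set (Matrix (Fin n) (Fin n) 𝕜)) =
        {A | A * star A = 1} ∩ {A | A.det = 1} := by
      ext A
      simp [Matrix.mem_specialUnitaryGroup_iff, Matrix.mem_unitaryGroup_iff]
    rw [this]
    refine IsClosed.inter (isClosed_eq ?_ continuous_const) (isClosed_eq ?_ continuous_const)
    · exact (continuous_id (X := Matrix (Fin n) (Fin n) 𝕜)).mul continuous_id.star
    · exact Continuous.matrix_det continuous_id
  · intro A hA i _ j _
    simpa using norm_entry_le_one hA i j

end Groups

/-- The Haar probability measure of a compact group. -/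
noncomputable def haarProb (G : Type*) [Group G] [TopologicalSpace G] [IsTopologicalGroup G]
    [CompactSpace G] [MeasurableSpace G] [BorelSpace G] : Measure G :=
  Measure.haarMeasure ⊤

/-- The abstracted gradient `Tr (U₋† ρ U₋ [H, U₊ O U₊†])`. -/
noncomputable def abstractedGradient {ι : Type*} [Fintype ι] (H O ρ Up Um : Matrix ι ι ℂ) : ℂ :=
  (Um.conjTranspose * ρ * Um *
    (H * (Up * O * Up.conjTranspose) - (Up * O * Up.conjTranspose) * H)).trace

/-- The abstracted gradient is real for a skew-Hermitian generator and Hermitian observable and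
state. -/
theorem abstractedGradient_im {ι : Type*} [Fintype ι] {H O ρ : Matrix ι ι ℂ}
    (Up Um : Matrix ι ι ℂ) (hH : H.conjTranspose = -H) (hO : O.IsHermitian)
    (hρ : ρ.IsHermitian) : (abstractedGradient H O ρ Up Um).im = 0 := by
  rw [← Complex.conj_eq_iff_im]
  have h1 := Matrix.trace_conjTranspose (Um.conjTranspose * ρ * Um *
    (H * (Up * O * Up.conjTranspose) - (Up * O * Up.conjTranspose) * H))
  unfold abstractedGradient
  rw [starRingEnd_apply, ← h1, Matrix.conjTranspose_mul, Matrix.trace_mul_comm]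
  congr 1
  simp only [Matrix.conjTranspose_sub, Matrix.conjTranspose_mul, Matrix.conjTranspose_conjTranspose,
    hH, hO.eq, hρ.eq, Matrix.mul_assoc]
  congr 1
  rw [sub_eq_add_neg, sub_eq_add_neg, add_comm]
  simp only [Matrix.neg_mul, Matrix.mul_neg, neg_neg]

/-- `GradVar`: the variance of the (real) abstracted gradient for independent Haar distributed
`g₊, g₋`, where `U_g = φ g`. -/
noncomputable def gradVar {G : Type*} [Group G] [TopologicalSpace G] [IsTopologicalGroup G]
    [CompactSpace G] [MeasurableSpace G] [BorelSpace G] {ι : Type*} [Fintype ι]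
    (φ : G → Matrix ι ι ℂ) (H O ρ : Matrix ι ι ℂ) : ℝ :=
  ProbabilityTheory.variance
    (fun g : G × G => (abstractedGradient H O ρ (φ g.1) (φ g.2)).re)
    ((haarProb G).prod (haarProb G))

/-- The quantum compound ansatz for `SU(n)`. -/
noncomputable def compoundSU {n : ℕ} (g : Matrix.specialUnitaryGroup (Fin n) ℂ) :
    Matrix (Qubits n) (Qubits n) ℂ :=
  compoundMatrix (g : Matrix (Fin n) (Fin n) ℂ)

/-- The quantum compound ansatz for `SO(n)`. -/
noncomputable def compoundSO {n : ℕ} (g : Matrix.specialOrthogonalGroup (Fin n) ℝ) :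
    Matrix (Qubits n) (Qubits n) ℂ :=
  compoundMatrix ((g : Matrix (Fin n) (Fin n) ℝ).map Complex.ofReal)

/-- The Lie algebra `su(n)`: traceless skew-Hermitian matrices. -/
def suSet (n : ℕ) : Set (Matrix (Fin n) (Fin n) ℂ) :=
  {h | h.conjTranspose = -h ∧ h.trace = 0}

/-- The Lie algebra `so(n)`: the matrices in `su(n)` with real entries. -/
def soSet (n : ℕ) : Set (Matrix (Fin n) (Fin n) ℂ) :=
  {h | h ∈ suSet n ∧ ∀ i j, (h i j).im = 0}

/-- The squared standard norm `-Tr (h²)` on `su(n)`. -/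
noncomputable def stdNormSq {n : ℕ} (h : Matrix (Fin n) (Fin n) ℂ) : ℝ :=
  (-(h * h).trace).re

/-- The Pauli matrix `σ_x` on the block of the rows and columns `i`, `j`. -/
def pauliX {n : ℕ} (i j : Fin n) : Matrix (Fin n) (Fin n) ℂ :=
  Matrix.single i j 1 + Matrix.single j i 1

/-- The Pauli matrix `σ_y` on the block of the rows and columns `i`, `j`. -/
def pauliY {n : ℕ} (i j : Fin n) : Matrix (Fin n) (Fin n) ℂ :=
  Matrix.single i j (-Complex.I) + Matrix.single j i Complex.I

/-- The Pauli matrix `σ_z` on the block of the rows and columns `i`, `j`. -/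
def pauliZ {n : ℕ} (i j : Fin n) : Matrix (Fin n) (Fin n) ℂ :=
  Matrix.single i i 1 - Matrix.single j j 1

/-- The generators `-(i/2) X^(ij)`, `-(i/2) Y^(ij)`, `-(i/2) Z^(ij)` of the Givens rotations of
`SU(n)`. -/
def suGenerators (n : ℕ) : Set (Matrix (Fin n) (Fin n) ℂ) :=
  {h | ∃ i j : Fin n, i ≠ j ∧
    (h = (-(Complex.I / 2)) • pauliX i j ∨ h = (-(Complex.I / 2)) • pauliY i j ∨
      h = (-(Complex.I / 2)) • pauliZ i j)}

/-- The generators `-(i/2) Y^(ij)` of the Givens rotations of `SO(n)`. -/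
def soGenerators (n : ℕ) : Set (Matrix (Fin n) (Fin n) ℂ) :=
  {h | ∃ i j : Fin n, i ≠ j ∧ h = (-(Complex.I / 2)) • pauliY i j}

section DLA

attribute [local instance] LieRing.ofAssociativeRing

/-- The dynamical Lie algebra of the compound ansatz with a given set of generators: the real
Lie algebra of matrices on the qubits (with the commutator as bracket) that the represented
generators generate. -/
noncomputable def compoundDLA {n : ℕ} (S : Set (Matrix (Fin n) (Fin n) ℂ)) :
    Set (Matrix (Qubits n) (Qubits n) ℂ) :=
  LieSubalgebra.lieSpan ℝ (Matrix (Qubits n) (Qubits n) ℂ) (compoundDifferential '' S)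

end DLA

/-- The Pauli operator `σ_z` on qubit `i`. -/
def sigmaZ {n : ℕ} (i : Fin n) : Matrix (Qubits n) (Qubits n) ℂ :=
  Matrix.diagonal fun s => if s i = 0 then 1 else -1

/-- The computational basis state `|s⟩`. -/
def basisKet {n : ℕ} (s : Qubits n) : Qubits n → ℂ := Pi.single s 1

/-- The uniform superposition of all computational basis states. -/
noncomputable def plusKet (n : ℕ) : Qubits n → ℂ := fun _ => (1 / Real.sqrt (2 ^ n) : ℝ)

/-- The density matrix `|ψ⟩⟨ψ|`. -/
def pureState {ι : Type*} (ψ : ι → ℂ) : Matrix ι ι ℂ := Matrix.vecMulVec ψ (star ψ)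

/-- The initial states: the computational basis states, other than `|0…0⟩` and `|1…1⟩` (which the
whole ansatz fixes), and the uniform superposition. -/
def IsInitialKet {n : ℕ} (ψ : Qubits n → ℂ) : Prop :=
  (∃ s : Qubits n, (∃ i j, s i ≠ s j) ∧ ψ = basisKet s) ∨ ψ = plusKet n

/-- `∑ᵢ (cᵢ - c̄)²`, with `c̄` the mean of the `cᵢ`. -/
noncomputable def spread {n : ℕ} (c : Fin n → ℝ) : ℝ :=
  ∑ i, (c i - (∑ j, c j) / n) ^ 2

/-! Since `σ^z_j` is the identity minus twice the occupation number of mode `j`, the observable `∑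
c_j σ^z_j` is a scalar minus `2 dφ(diag c)`. The scalar is what keeps `iσ^z_j` out of the dynamical
Lie algebra: every `dφ(h)` has zero row at `0…0`, a property stable under brackets, while `iσ^z_j`
has a nonzero entry there. The commutator with `H` does not see scalars, so the gradient is still
governed by `n × n` matrices. As `φ` is multiplicative and `dφ` is equivariant and respects
brackets, the gradient equals `-2 Tr(ρ dφ(g₂ [h, g₁ D g₁†] g₂†))` with `D = diag(c - c̄)`
(`abstractedGradient_compound`).

On traceless Hermitian matrices the functional `M ↦ Re Tr(ρ dφ(M))` is pairing with a traceless
Hermitian `B`. The gradient is thus `-2 Re Tr(g₂ M g₂† B)` with `M = [h, g₁ D g₁†]`, whose mean over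
`g₂` is zero. Both groups are treated at once, as the special unitary group over `𝕜 = ℂ` or `𝕜 = ℝ`;
in the real case `D` and `B` are symmetric and so lie outside `so(n)`, but they are in the module of
traceless symmetric matrices, which suffices.

The analytic core is `∫ (Re Tr(g A g† B))² = e ‖A‖² ‖B‖²` with `e ≥ 1/(n(n+1))`, in Frobenius norms
(`exists_integral_adjointCoeff_sq`). Diagonalising `A` and `B` turns the integrand into the square
of a bilinear form in the numbers `|g_ij|²`. Permutation invariance leaves four second moments of
these; the unit row and column sums relate them, and one inequality from mixing two columns
(`two_mul_entryMoment_le`) bounds `e` from below.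

The formula is used twice. Over `g₂` it gives `4e ‖B‖² ‖M‖²`. Over `g₁`, testing `M` against the
matrices `E_jk + E_kj` gives `∫ ‖M‖² ≥ e n ‖D‖² ‖h‖²` (`le_integral_frobSq_lie`). Finally `‖B‖² ≥
1/8` by Cauchy–Schwarz, because each initial state has a traceless Hermitian `S` with `‖S‖² = 2` and
expectation at least `1/2` (`exists_witness`). -/

/-! ### Compound matrices: multiplicativity, adjoints, diagonal matrices. -/

/-- The `k`-th compound matrix, as the matrix of the map induced on the `k`-th exterior power. -/
noncomputable def exteriorPowerMatrix {n : ℕ} (k : ℕ) (A : Matrix (Fin n) (Fin n) ℂ) :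
    Matrix (Set.powersetCard (Fin n) k) (Set.powersetCard (Fin n) k) ℂ :=
  LinearMap.toMatrix ((Pi.basisFun ℂ (Fin n)).exteriorPower k)
    ((Pi.basisFun ℂ (Fin n)).exteriorPower k) (exteriorPower.map k (Matrix.toLin' A))

theorem exteriorPowerMatrix_mul {n : ℕ} (k : ℕ) (A B : Matrix (Fin n) (Fin n) ℂ) :
    exteriorPowerMatrix k (A * B) = exteriorPowerMatrix k A * exteriorPowerMatrix k B := by
  unfold exteriorPowerMatrix
  rw [Matrix.toLin'_mul, ← LinearMap.toMatrix_comp, exteriorPower.map_comp]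

theorem exteriorPowerMatrix_apply {n : ℕ} (k : ℕ) (A : Matrix (Fin n) (Fin n) ℂ)
    (S T : Set.powersetCard (Fin n) k) :
    exteriorPowerMatrix k A S T =
      (A.submatrix (S.1.orderEmbOfFin S.2) (T.1.orderEmbOfFin T.2)).det := by
  unfold exteriorPowerMatrix
  rw [LinearMap.toMatrix_apply, exteriorPower.basis_apply, exteriorPower.basis_repr_apply,
    exteriorPower.ιMulti_family, exteriorPower.map_apply_ιMulti,
    exteriorPower.ιMultiDual_apply_ιMulti, ← Matrix.det_transpose]
  congr 1
  ext i j
  simp [Set.powersetCard.ofFinEmbEquiv_symm_apply]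

theorem compoundMatrix_apply_of_card {n : ℕ} (A : Matrix (Fin n) (Fin n) ℂ) {s t : Qubits n}
    {k : ℕ} (hs : (occupied s).card = k) (ht : (occupied t).card = k) :
    compoundMatrix A s t =
      (A.submatrix ((occupied s).orderEmbOfFin hs) ((occupied t).orderEmbOfFin ht)).det := by
  subst hs
  simp [compoundMatrix, ht]

theorem compoundMatrix_apply_of_ne {n : ℕ} (A : Matrix (Fin n) (Fin n) ℂ) {s t : Qubits n}
    (h : (occupied t).card ≠ (occupied s).card) : compoundMatrix A s t = 0 := by
  simp [compoundMatrix, h]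

theorem mem_occupied {n : ℕ} {s : Qubits n} {i : Fin n} : i ∈ occupied s ↔ s i = 1 := by
  simp [occupied]

theorem occupied_injective {n : ℕ} : Function.Injective (occupied (n := n)) := by
  intro s t h
  funext i
  have h1 : s i = 1 ↔ t i = 1 := by rw [← mem_occupied, ← mem_occupied, h]
  generalize s i = a at *
  generalize t i = b at *
  revert a b
  decide

/-- The bit string with a given set of ones. -/
def ofOccupied {n : ℕ} (S : Finset (Fin n)) : Qubits n := fun i => if i ∈ S then 1 else 0

theorem occupied_ofOccupied {n : ℕ} (S : Finset (Fin n)) : occupied (ofOccupied S) = S := by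
  ext i
  simp [mem_occupied, ofOccupied]

/-- **Cauchy–Binet**: the compound is multiplicative. -/
theorem compoundMatrix_mul {n : ℕ} (A B : Matrix (Fin n) (Fin n) ℂ) :
    compoundMatrix (A * B) = compoundMatrix A * compoundMatrix B := by
  ext s t
  rw [Matrix.mul_apply]
  by_cases h : (occupied t).card = (occupied s).card
  -- Cauchy–Binet is functoriality of the exterior power of degree the weight of `s`, read in
  -- coordinates. Intermediate strings of any other weight contribute zero.
  · have key := congrFun (congrFun (exteriorPowerMatrix_mul (occupied s).card A B)
      ⟨occupied s, rfl⟩) ⟨occupied t, h⟩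
    rw [Matrix.mul_apply, exteriorPowerMatrix_apply] at key
    rw [compoundMatrix_apply_of_card _ rfl h, key]
    have h0 : ∀ u : Qubits n, u ∉ Finset.univ.filter
        (fun u : Qubits n => (occupied u).card = (occupied s).card) →
        compoundMatrix A s u * compoundMatrix B u t = 0 := by
      intro u hu
      rw [compoundMatrix_apply_of_ne A (by simpa using hu), zero_mul]
    rw [← Finset.sum_subset (Finset.subset_univ _) fun u _ hu => h0 u hu]
    refine Finset.sum_bij (fun S _ => ofOccupied S.1) ?_ ?_ ?_ ?_
    · intro S _
      simp only [Finset.mem_filter, Finset.mem_univ, true_and, occupied_ofOccupied]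
      exact S.2
    · intro S _ T _ hST
      have := congrArg occupied hST
      rw [occupied_ofOccupied, occupied_ofOccupied] at this
      exact Subtype.ext this
    · intro u hu
      refine ⟨⟨occupied u, by simpa using hu⟩, Finset.mem_univ _, ?_⟩
      exact occupied_injective (occupied_ofOccupied _)
    · intro S _
      have hS : (occupied (ofOccupied S.1)).card = (occupied s).card := by
        rw [occupied_ofOccupied]; exact S.2
      rw [compoundMatrix_apply_of_card A rfl hS, compoundMatrix_apply_of_card B hS h,
        exteriorPowerMatrix_apply, exteriorPowerMatrix_apply]
      simp only [occupied_ofOccupied]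
  · rw [compoundMatrix_apply_of_ne _ h]
    refine (Finset.sum_eq_zero fun u _ => ?_).symm
    by_cases hu : (occupied u).card = (occupied s).card
    · rw [compoundMatrix_apply_of_ne B (by rw [hu]; exact h), mul_zero]
    · rw [compoundMatrix_apply_of_ne A hu, zero_mul]

theorem compoundMatrix_transpose {n : ℕ} (A : Matrix (Fin n) (Fin n) ℂ) :
    compoundMatrix A.transpose = (compoundMatrix A).transpose := by
  ext s t
  rw [Matrix.transpose_apply]
  by_cases h : (occupied t).card = (occupied s).card
  · rw [compoundMatrix_apply_of_card _ rfl h, compoundMatrix_apply_of_card _ h rfl,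
      ← Matrix.det_transpose, Matrix.transpose_submatrix, Matrix.transpose_transpose]
  · rw [compoundMatrix_apply_of_ne _ h, compoundMatrix_apply_of_ne _ (Ne.symm h)]

theorem compoundMatrix_map_star {n : ℕ} (A : Matrix (Fin n) (Fin n) ℂ) :
    compoundMatrix (A.map star) = (compoundMatrix A).map star := by
  ext s t
  rw [Matrix.map_apply]
  by_cases h : (occupied t).card = (occupied s).card
  · rw [compoundMatrix_apply_of_card _ rfl h, compoundMatrix_apply_of_card _ rfl h]
    exact (RingHom.map_det (starRingEnd ℂ) _).symm
  · rw [compoundMatrix_apply_of_ne _ h, compoundMatrix_apply_of_ne _ h, star_zero]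

theorem compoundMatrix_conjTranspose {n : ℕ} (A : Matrix (Fin n) (Fin n) ℂ) :
    compoundMatrix A.conjTranspose = (compoundMatrix A).conjTranspose := by
  rw [Matrix.conjTranspose, compoundMatrix_map_star, compoundMatrix_transpose]
  rfl

theorem compoundMatrix_diagonal {n : ℕ} (d : Fin n → ℂ) :
    compoundMatrix (Matrix.diagonal d) =
      Matrix.diagonal fun s => ∏ i ∈ occupied s, d i := by
  ext s t
  by_cases h : (occupied t).card = (occupied s).card
  · rw [compoundMatrix_apply_of_card _ rfl h]
    by_cases hst : s = t
    · subst hst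
      rw [Matrix.submatrix_diagonal _ _ ((occupied s).orderEmbOfFin rfl).injective,
        Matrix.det_diagonal, Matrix.diagonal_apply_eq]
      have := Finset.prod_map Finset.univ ((occupied s).orderEmbOfFin rfl).toEmbedding d
      rw [Finset.map_orderEmbOfFin_univ] at this
      exact this.symm
    · rw [Matrix.diagonal_apply_ne _ hst]
      -- Distinct sets of equal size: some column index is missing among the rows, so that column of
      -- the minor vanishes.
      have : ¬ occupied t ⊆ occupied s := fun hsub =>
        hst (occupied_injective (Finset.eq_of_subset_of_card_le hsub h.ge).symm)
      obtain ⟨i, hit, his⟩ := Finset.not_subset.1 this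
      obtain ⟨c, hc⟩ : i ∈ Set.range ((occupied t).orderEmbOfFin h) := by
        rw [Finset.range_orderEmbOfFin]; exact hit
      refine Matrix.det_eq_zero_of_column_eq_zero c fun r => ?_
      rw [Matrix.submatrix_apply, hc]
      refine Matrix.diagonal_apply_ne _ fun hr => his ?_
      rw [← hr]
      exact Finset.orderEmbOfFin_mem _ _ _
  · rw [compoundMatrix_apply_of_ne _ h, Matrix.diagonal_apply_ne]
    rintro rfl
    exact h rfl

theorem compoundMatrix_one {n : ℕ} :
    compoundMatrix (1 : Matrix (Fin n) (Fin n) ℂ) = 1 := by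
  rw [← Matrix.diagonal_one, compoundMatrix_diagonal]
  simp

/-! ### The differential of the compound as a Lie algebra representation. -/

/-- Entrywise differentiability of a curve of matrices. -/
def HasEntrywiseDerivAt {m p : Type*} (X : ℝ → Matrix m p ℂ) (X' : Matrix m p ℂ) (τ : ℝ) : Prop :=
  ∀ i j, HasDerivAt (fun x => X x i j) (X' i j) τ

namespace HasEntrywiseDerivAt

variable {m p q : Type*} {X : ℝ → Matrix m p ℂ} {X' X'' : Matrix m p ℂ} {Y : ℝ → Matrix p q ℂ}
  {Y' : Matrix p q ℂ} {τ : ℝ}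

theorem const (A : Matrix m p ℂ) (τ : ℝ) : HasEntrywiseDerivAt (fun _ => A) 0 τ :=
  fun i j => hasDerivAt_const τ (A i j)

theorem mul [Fintype p] (hX : HasEntrywiseDerivAt X X' τ) (hY : HasEntrywiseDerivAt Y Y' τ) :
    HasEntrywiseDerivAt (fun x => X x * Y x) (X' * Y τ + X τ * Y') τ := by
  intro i j
  simp only [Matrix.mul_apply, Matrix.add_apply, ← Finset.sum_add_distrib]
  exact HasDerivAt.fun_sum fun k _ => (hX i k).mul (hY k j)

theorem add_smul (A B : Matrix m p ℂ) :
    HasEntrywiseDerivAt (fun x : ℝ => A + x • B) B 0 := by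
  intro i j
  simpa using ((hasDerivAt_id (0 : ℝ)).smul_const (B i j)).const_add (A i j)

theorem unique (h1 : HasEntrywiseDerivAt X X' τ) (h2 : HasEntrywiseDerivAt X X'' τ) : X' = X'' := by
  ext i j
  exact (h1 i j).unique (h2 i j)

end HasEntrywiseDerivAt

section Exp

attribute [local instance] Matrix.linftyOpNormedRing Matrix.linftyOpNormedAlgebra

theorem hasEntrywiseDerivAt_exp {n : ℕ} (h : Matrix (Fin n) (Fin n) ℂ) :
    HasEntrywiseDerivAt (fun x : ℝ => NormedSpace.exp (x • h)) h 0 := by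
  intro i j
  have h1 := hasDerivAt_exp_smul_const (𝕂 := ℝ) h (0 : ℝ)
  rw [zero_smul, NormedSpace.exp_zero, one_mul] at h1
  let L : Matrix (Fin n) (Fin n) ℂ →L[ℝ] ℂ :=
    LinearMap.toContinuousLinearMap (Matrix.entryLinearMap ℝ ℂ i j)
  exact L.hasFDerivAt.comp_hasDerivAt (0 : ℝ) h1

end Exp

/-- The derivative of a minor at the identity, from the Leibniz formula. -/
noncomputable def minorDeriv {n k : ℕ} (e f : Fin k → Fin n) (h : Matrix (Fin n) (Fin n) ℂ) : ℂ :=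
  ∑ σ : Equiv.Perm (Fin k), ((Equiv.Perm.sign σ : ℤ) : ℂ) *
    ∑ r, (∏ r' ∈ Finset.univ.erase r, (1 : Matrix (Fin n) (Fin n) ℂ) (e (σ r')) (f r')) *
      h (e (σ r)) (f r)

theorem HasEntrywiseDerivAt.minor {n k : ℕ} (e f : Fin k → Fin n)
    {X : ℝ → Matrix (Fin n) (Fin n) ℂ} {h : Matrix (Fin n) (Fin n) ℂ}
    (hX : HasEntrywiseDerivAt X h 0) (h0 : X 0 = 1) :
    HasDerivAt (fun x => ((X x).submatrix e f).det) (minorDeriv e f h) 0 := by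
  simp only [Matrix.det_apply']
  refine HasDerivAt.fun_sum fun σ _ => HasDerivAt.const_mul _ ?_
  have := HasDerivAt.fun_finsetProd (u := Finset.univ)
    (f := fun (r : Fin k) x => (X x).submatrix e f (σ r) r)
    (f' := fun r => h (e (σ r)) (f r)) (x := (0 : ℝ)) fun r _ => hX (e (σ r)) (f r)
  simpa only [smul_eq_mul, Matrix.submatrix_apply, h0] using this

theorem HasEntrywiseDerivAt.compound_aux {n : ℕ} {X : ℝ → Matrix (Fin n) (Fin n) ℂ}
    {h : Matrix (Fin n) (Fin n) ℂ} (hX : HasEntrywiseDerivAt X h 0) (h0 : X 0 = 1)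
    (s t : Qubits n) :
    HasDerivAt (fun x => compoundMatrix (X x) s t)
      (if hc : (occupied t).card = (occupied s).card then
        minorDeriv ((occupied s).orderEmbOfFin rfl) ((occupied t).orderEmbOfFin hc) h else 0) 0 := by
  by_cases hc : (occupied t).card = (occupied s).card
  · simp only [compoundMatrix, Matrix.of_apply, hc, dif_pos]
    exact hX.minor _ _ h0
  · simp only [compoundMatrix, Matrix.of_apply, hc]
    exact hasDerivAt_const _ _

theorem compoundDifferential_apply {n : ℕ} (h : Matrix (Fin n) (Fin n) ℂ) (s t : Qubits n) :
    compoundDifferential h s t =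
      if hc : (occupied t).card = (occupied s).card then
        minorDeriv ((occupied s).orderEmbOfFin rfl) ((occupied t).orderEmbOfFin hc) h else 0 :=
  ((hasEntrywiseDerivAt_exp h).compound_aux (by simp) s t).deriv

/-- The chain rule for the compound at the identity. -/
theorem HasEntrywiseDerivAt.compound {n : ℕ} {X : ℝ → Matrix (Fin n) (Fin n) ℂ}
    {h : Matrix (Fin n) (Fin n) ℂ} (hX : HasEntrywiseDerivAt X h 0) (h0 : X 0 = 1) :
    HasEntrywiseDerivAt (fun x => compoundMatrix (X x)) (compoundDifferential h) 0 := by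
  intro s t
  rw [compoundDifferential_apply]
  exact hX.compound_aux h0 s t

/-- Only the velocity of a curve through the identity matters, so an affine curve may replace the
exponential. This makes explicit computations of the differential algebraic. -/
theorem hasEntrywiseDerivAt_compound_add {n : ℕ} (h : Matrix (Fin n) (Fin n) ℂ) :
    HasEntrywiseDerivAt (fun x : ℝ => compoundMatrix (1 + x • h)) (compoundDifferential h) 0 :=
  (HasEntrywiseDerivAt.add_smul 1 h).compound (by simp)

/-- The differential of the compound at the identity as a linear map. -/
noncomputable def compoundDifferentialLin (n : ℕ) :
    Matrix (Fin n) (Fin n) ℂ →ₗ[ℂ] Matrix (Qubits n) (Qubits n) ℂ where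
  toFun := compoundDifferential
  map_add' A B := by
    ext s t
    rw [Matrix.add_apply]
    simp only [compoundDifferential_apply]
    split_ifs
    · simp only [minorDeriv, Matrix.add_apply, mul_add, Finset.sum_add_distrib]
    · simp
  map_smul' a A := by
    ext s t
    rw [Matrix.smul_apply]
    simp only [compoundDifferential_apply]
    split_ifs
    · simp only [minorDeriv, Matrix.smul_apply, smul_eq_mul, RingHom.id_apply, Finset.mul_sum]
      refine Finset.sum_congr rfl fun σ _ => Finset.sum_congr rfl fun r _ => ?_
      ring
    · simp

theorem compoundDifferential_add {n : ℕ} (A B : Matrix (Fin n) (Fin n) ℂ) :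
    compoundDifferential (A + B) = compoundDifferential A + compoundDifferential B :=
  map_add (compoundDifferentialLin n) A B

theorem compoundDifferential_transpose {n : ℕ} (A : Matrix (Fin n) (Fin n) ℂ) :
    compoundDifferential A.transpose = (compoundDifferential A).transpose := by
  refine (hasEntrywiseDerivAt_compound_add A.transpose).unique fun s t => ?_
  have h : ∀ x : ℝ, compoundMatrix (1 + x • A.transpose) s t = compoundMatrix (1 + x • A) t s := by
    intro x
    rw [← Matrix.transpose_apply (compoundMatrix (1 + x • A)), ← compoundMatrix_transpose,
      Matrix.transpose_add, Matrix.transpose_smul, Matrix.transpose_one]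
  simp only [h]
  exact hasEntrywiseDerivAt_compound_add A t s

/-- Equivariance of the differential. -/
theorem compound_conj {n : ℕ} {P Q : Matrix (Fin n) (Fin n) ℂ} (hPQ : P * Q = 1)
    (A : Matrix (Fin n) (Fin n) ℂ) :
    compoundMatrix P * compoundDifferential A * compoundMatrix Q =
      compoundDifferential (P * A * Q) := by
  refine HasEntrywiseDerivAt.unique ?_ (hasEntrywiseDerivAt_compound_add (P * A * Q))
  have h1 := ((HasEntrywiseDerivAt.const (compoundMatrix P) 0).mul
    (hasEntrywiseDerivAt_compound_add A)).mul (HasEntrywiseDerivAt.const (compoundMatrix Q) 0)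
  have h2 : ∀ x : ℝ, compoundMatrix P * compoundMatrix (1 + x • A) * compoundMatrix Q =
      compoundMatrix (1 + x • (P * A * Q)) := by
    intro x
    rw [← compoundMatrix_mul, ← compoundMatrix_mul]
    congr 1
    rw [mul_add, add_mul, mul_one, hPQ, mul_smul_comm, smul_mul_assoc]
  simpa only [h2, zero_mul, mul_zero, zero_add, add_zero] using h1

theorem exp_smul_mul_exp_smul_neg {n : ℕ} (h : Matrix (Fin n) (Fin n) ℂ) (x : ℝ) :
    NormedSpace.exp (x • h) * NormedSpace.exp (x • -h) = 1 := by
  rw [smul_neg, ← Matrix.exp_add_of_commute (x • h) (-(x • h)) (Commute.refl (x • h)).neg_right,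
    add_neg_cancel, NormedSpace.exp_zero]

/-- The differential is a Lie algebra homomorphism. -/
theorem compoundDifferential_lie {n : ℕ} (h A : Matrix (Fin n) (Fin n) ℂ) :
    compoundDifferential (h * A - A * h) =
      compoundDifferential h * compoundDifferential A -
        compoundDifferential A * compoundDifferential h := by
  have e1 := hasEntrywiseDerivAt_exp h
  have e2 := hasEntrywiseDerivAt_exp (-h)
  -- The curve `φ(e^{xh}) dφ(A) φ(e^{-xh}) = dφ(e^{xh} A e^{-xh})` is differentiated at `0` in two
  -- ways: `l1` by the product rule on the left side, `l2` inside the argument on the right, through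
  -- which `dφ` passes by linearity.
  have l1 := ((e1.compound (by simp)).mul
    (HasEntrywiseDerivAt.const (compoundDifferential A) 0)).mul (e2.compound (by simp))
  have l2 := (e1.mul (HasEntrywiseDerivAt.const A 0)).mul e2
  simp only [compound_conj (exp_smul_mul_exp_smul_neg h _)] at l1
  have neg : compoundDifferential (-h) = -compoundDifferential h :=
    map_neg (compoundDifferentialLin n) h
  simp only [zero_smul, NormedSpace.exp_zero, compoundMatrix_one, mul_one, one_mul, mul_zero,
    add_zero, mul_neg, neg, ← sub_eq_add_neg] at l1 l2
  refine HasEntrywiseDerivAt.unique (fun s t => ?_) l1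
  simp only [compoundDifferential_apply]
  split_ifs with hc
  · unfold minorDeriv
    refine HasDerivAt.fun_sum fun σ _ => HasDerivAt.const_mul _ ?_
    refine HasDerivAt.fun_sum fun r _ => HasDerivAt.const_mul _ ?_
    exact l2 _ _
  · exact hasDerivAt_const _ _

theorem compoundDifferential_diagonal {n : ℕ} (c : Fin n → ℂ) :
    compoundDifferential (Matrix.diagonal c) = Matrix.diagonal fun s => ∑ i ∈ occupied s, c i := by
  refine HasEntrywiseDerivAt.unique (hasEntrywiseDerivAt_compound_add _) fun s t => ?_
  have h : ∀ x : ℝ, (1 : Matrix (Fin n) (Fin n) ℂ) + x • Matrix.diagonal c =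
      Matrix.diagonal fun i => 1 + x • c i := by
    intro x
    rw [← Matrix.diagonal_smul, ← Matrix.diagonal_one, Matrix.diagonal_add]
    rfl
  simp only [h, compoundMatrix_diagonal]
  by_cases hst : s = t
  · subst hst
    simp only [Matrix.diagonal_apply_eq]
    have := HasDerivAt.fun_finsetProd (u := occupied s) (f := fun i (x : ℝ) => 1 + x • c i)
      (f' := fun i => c i) (x := (0 : ℝ)) fun i _ => by
        simpa using ((hasDerivAt_id (0 : ℝ)).smul_const (c i)).const_add 1
    simpa using this
  · simp only [Matrix.diagonal_apply_ne _ hst]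
    exact hasDerivAt_const _ _

/-- On a basis state `σ_z` is `1` minus twice the occupation number, and a weighted sum of
occupation numbers is the differential of a diagonal matrix. -/
theorem sum_smul_sigmaZ {n : ℕ} (c : Fin n → ℝ) :
    ∑ i, (c i : ℂ) • sigmaZ i = ((∑ i, c i : ℝ) : ℂ) • (1 : Matrix (Qubits n) (Qubits n) ℂ) -
      (2 : ℂ) • compoundDifferential (Matrix.diagonal fun i => (c i : ℂ)) := by
  rw [compoundDifferential_diagonal, ← Matrix.diagonal_one]
  ext s t
  simp only [sigmaZ, Matrix.sum_apply, Matrix.smul_apply, Matrix.sub_apply]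
  by_cases hst : s = t
  · subst hst
    simp only [Matrix.diagonal_apply_eq, smul_eq_mul, occupied, Finset.sum_filter, Finset.mul_sum,
      Complex.ofReal_sum, Finset.sum_mul, ← Finset.sum_sub_distrib]
    refine Finset.sum_congr rfl fun i _ => ?_
    generalize s i = a
    fin_cases a
    · simp
    · simp
      ring
  · simp [Matrix.diagonal_apply_ne _ hst]

/-! ### The vacuum row and the dynamical Lie algebra. -/

/-- The vacuum row of a compound consists of an empty minor and zeros by weight, so it does not
depend on the matrix and its derivative vanishes. -/
theorem compoundDifferential_zero_apply {n : ℕ} (h : Matrix (Fin n) (Fin n) ℂ) (t : Qubits n) :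
    compoundDifferential h 0 t = 0 := by
  have h0 : (occupied (0 : Qubits n)).card = 0 := by simp [occupied]
  have h1 : ∀ x : ℝ, compoundMatrix (1 + x • h) 0 t = (1 : Matrix (Qubits n) (Qubits n) ℂ) 0 t := by
    intro x
    rw [← compoundMatrix_one]
    by_cases ht : (occupied t).card = 0
    · rw [compoundMatrix_apply_of_card _ h0 ht, compoundMatrix_apply_of_card _ h0 ht]
      simp
    · rw [compoundMatrix_apply_of_ne _ (by rwa [h0]), compoundMatrix_apply_of_ne _ (by rwa [h0])]
  have h2 := hasEntrywiseDerivAt_compound_add h 0 t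
  simp only [h1] at h2
  exact h2.unique (hasDerivAt_const _ _)

section DLA

attribute [local instance] LieRing.ofAssociativeRing

/-- The Lie subalgebra of the operators that annihilate the functional `⟨0…0|`. -/
def vacuumAnnihilator (n : ℕ) : LieSubalgebra ℝ (Matrix (Qubits n) (Qubits n) ℂ) where
  carrier := {A | ∀ t, A 0 t = 0}
  add_mem' hA hB t := by rw [Matrix.add_apply, hA t, hB t, add_zero]
  zero_mem' _ := rfl
  smul_mem' a A hA t := by rw [Matrix.smul_apply, hA t, smul_zero]
  lie_mem' {A B} hA hB t := by
    rw [LieRing.of_associative_ring_bracket, Matrix.sub_apply, Matrix.mul_apply, Matrix.mul_apply,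
      Finset.sum_eq_zero fun u _ => by rw [hA u, zero_mul],
      Finset.sum_eq_zero fun u _ => by rw [hB u, zero_mul], sub_zero]

theorem I_smul_sigmaZ_notMem_compoundDLA {n : ℕ} (S : Set (Matrix (Fin n) (Fin n) ℂ)) (i : Fin n) :
    Complex.I • sigmaZ i ∉ compoundDLA S := by
  intro hmem
  have hle : LieSubalgebra.lieSpan ℝ (Matrix (Qubits n) (Qubits n) ℂ)
      (compoundDifferential '' S) ≤ vacuumAnnihilator n := by
    rw [LieSubalgebra.lieSpan_le]
    rintro _ ⟨h, _, rfl⟩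
    exact compoundDifferential_zero_apply h
  have h0 : (Complex.I • sigmaZ i) (0 : Qubits n) 0 = 0 := hle hmem 0
  simp [sigmaZ] at h0

end DLA

/-! ### The hopping operator between the first two modes. -/

/-- The bit string with the ones at `0` moved to `1`. -/
def hopZeroOne {m : ℕ} (s : Qubits (m + 2)) : Qubits (m + 2) :=
  ofOccupied (insert 1 ((occupied s).erase 0))

theorem card_occupied_hopZeroOne {m : ℕ} {s : Qubits (m + 2)} (h0 : s 0 = 1) (h1 : s 1 ≠ 1) :
    (occupied (hopZeroOne s)).card = (occupied s).card := by
  rw [hopZeroOne, occupied_ofOccupied, Finset.card_insert_of_notMem, Finset.card_erase_add_one]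
  · exact mem_occupied.2 h0
  · exact fun h => h1 (mem_occupied.1 (Finset.mem_of_mem_erase h))

/-- A determinant is affine in each row, and by injectivity of `e` only row `r` meets the
perturbation; it contributes the minor with row index `0` replaced by `1`. -/
theorem minor_add_single {m k : ℕ} (e f : Fin k → Fin (m + 2)) (he : Function.Injective e)
    {r : Fin k} (hr : e r = 0) (x : ℝ) :
    (((1 : Matrix (Fin (m + 2)) (Fin (m + 2)) ℂ) + x • Matrix.single 0 1 1).submatrix e f).det =
      (Matrix.submatrix 1 e f).det +
        x • (Matrix.submatrix (1 : Matrix (Fin (m + 2)) (Fin (m + 2)) ℂ)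
          (Function.update e r 1) f).det := by
  have h1 : ((1 : Matrix (Fin (m + 2)) (Fin (m + 2)) ℂ) + x • Matrix.single 0 1 1).submatrix e f =
      (Matrix.submatrix 1 e f).updateRow r (Matrix.submatrix 1 e f r + (x : ℂ) • fun c =>
        (1 : Matrix (Fin (m + 2)) (Fin (m + 2)) ℂ) 1 (f c)) := by
    ext a c
    by_cases ha : a = r
    · subst ha
      simp [hr, Matrix.single_apply, Matrix.one_apply]
    · have hea : e a ≠ 0 := fun h => ha (he (h.trans hr.symm))
      simp [Matrix.updateRow_ne ha, hea.symm]
  have h2 : Matrix.submatrix (1 : Matrix (Fin (m + 2)) (Fin (m + 2)) ℂ)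
          (Function.update e r 1) f =
      (Matrix.submatrix 1 e f).updateRow r fun c =>
        (1 : Matrix (Fin (m + 2)) (Fin (m + 2)) ℂ) 1 (f c) := by
    ext a c
    by_cases ha : a = r
    · rw [ha, Matrix.submatrix_apply, Matrix.updateRow_self, Function.update_self]
    · rw [Matrix.submatrix_apply, Matrix.updateRow_ne ha, Function.update_of_ne ha,
        Matrix.submatrix_apply]
  rw [h1, Matrix.det_updateRow_add, Matrix.det_updateRow_smul, Matrix.updateRow_eq_self, h2]
  simp

theorem compoundDifferential_single_zero_one {m : ℕ} (s t : Qubits (m + 2)) :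
    compoundDifferential (Matrix.single 0 1 1) s t =
      if s 0 = 1 ∧ s 1 = 0 then (1 : Matrix _ _ ℂ) (hopZeroOne s) t else 0 := by
  have hd := hasEntrywiseDerivAt_compound_add
    (Matrix.single 0 1 1 : Matrix (Fin (m + 2)) (Fin (m + 2)) ℂ) s t
  by_cases hc : (occupied t).card = (occupied s).card
  swap
  · simp only [compoundMatrix_apply_of_ne _ hc] at hd
    rw [hd.unique (hasDerivAt_const _ _)]
    split_ifs with h
    · rw [Matrix.one_apply_ne]
      rintro rfl
      exact hc (card_occupied_hopZeroOne h.1 (by simp [h.2]))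
    · rfl
  simp only [compoundMatrix_apply_of_card _ rfl hc] at hd
  set e := (occupied s).orderEmbOfFin rfl
  set f := (occupied t).orderEmbOfFin hc
  have hmem : ∀ a, s (e a) = 1 := fun a => mem_occupied.1 (Finset.orderEmbOfFin_mem _ _ a)
  have hrange : ∀ i, s i = 1 → ∃ a, e a = i := by
    intro i hi
    have : i ∈ Set.range e := by
      rw [Finset.range_orderEmbOfFin]; exact mem_occupied.2 hi
    exact this
  by_cases h0 : s 0 = 1
  swap
  · rw [if_neg fun h => h0 h.1]
    have hcst : ∀ x : ℝ, ((1 : Matrix (Fin (m + 2)) (Fin (m + 2)) ℂ) +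
        x • Matrix.single 0 1 1).submatrix e f = Matrix.submatrix 1 e f := by
      intro x
      ext a c
      have : e a ≠ 0 := fun h => h0 (by rw [← h]; exact hmem a)
      simp [this.symm]
    simp only [hcst] at hd
    exact hd.unique (hasDerivAt_const _ _)
  obtain ⟨r, hr⟩ := hrange 0 h0
  simp only [minor_add_single e f e.injective hr] at hd
  have hval := hd.unique (by
    simpa using ((hasDerivAt_id (0 : ℝ)).smul_const (Matrix.submatrix
      (1 : Matrix (Fin (m + 2)) (Fin (m + 2)) ℂ) (Function.update e r 1) f).det).const_add
        (Matrix.submatrix (1 : Matrix (Fin (m + 2)) (Fin (m + 2)) ℂ) e f).det)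
  rw [hval]
  -- If mode `1` is already occupied, the replaced minor has two equal rows: the exclusion
  -- principle.
  by_cases h1 : s 1 = 1
  · rw [if_neg fun h => by simp [h.2] at h1]
    obtain ⟨r', hr'⟩ := hrange 1 h1
    have hne : r' ≠ r := by
      rintro rfl
      rw [hr] at hr'
      simp at hr'
    refine Matrix.det_zero_of_row_eq hne ?_
    funext c
    rw [Matrix.submatrix_apply, Matrix.submatrix_apply, Function.update_of_ne hne, hr',
      Function.update_self]
  · have h1' : s 1 = 0 := by
      generalize s 1 = a at *
      revert a; decide
    rw [if_pos ⟨h0, h1'⟩, ← compoundMatrix_one,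
      compoundMatrix_apply_of_card _ (card_occupied_hopZeroOne h0 h1) hc]
    -- Replacing `0` by `1` keeps the row indices increasing, since no index lies between them.
    -- Hence the hop carries no sign, and the sum over all basis states has no cancellation.
    congr 2
    refine Finset.orderEmbOfFin_unique _ (fun a => ?_) fun a b hab => ?_
    · rw [hopZeroOne, occupied_ofOccupied]
      by_cases ha : a = r
      · subst ha; simp
      · rw [Function.update_of_ne ha]
        refine Finset.mem_insert_of_mem (Finset.mem_erase.2 ⟨?_, Finset.orderEmbOfFin_mem _ _ a⟩)
        exact fun h => ha (e.injective (h.trans hr.symm))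
    · have hb : b ≠ r := by
        rintro rfl
        have := e.strictMono hab
        rw [hr] at this
        exact absurd this (Fin.not_lt_zero _)
      rw [Function.update_of_ne hb]
      by_cases ha : a = r
      · subst ha
        rw [Function.update_self]
        have hb0 : e b ≠ 0 := fun h => hb (e.injective (h.trans hr.symm))
        have hb1 : e b ≠ 1 := fun h => h1 (by rw [← h]; exact hmem b)
        exact lt_of_le_of_ne (Fin.one_le_of_ne_zero hb0) hb1.symm
      · rw [Function.update_of_ne ha]
        exact e.strictMono hab

theorem card_filter_zero_one (m : ℕ) :
    (Finset.univ.filter fun s : Qubits (m + 2) => s 0 = 1 ∧ s 1 = 0).card = 2 ^ m := by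
  have h : (Finset.univ.filter fun s : Qubits (m + 2) => s 0 = 1 ∧ s 1 = 0) =
      Fintype.piFinset (fun i : Fin (m + 2) =>
        if i = 0 then {1} else if i = 1 then {0} else Finset.univ) := by
    ext s
    simp only [Finset.mem_filter, Finset.mem_univ, true_and, Fintype.mem_piFinset]
    constructor
    · rintro ⟨h0, h1⟩ i
      split_ifs with hi hi'
      · simp [hi, h0]
      · simp [hi', h1]
      · simp
    · intro h
      exact ⟨by simpa using h 0, by simpa using h 1⟩
  rw [h, Fintype.card_piFinset, Fin.prod_univ_succ, Fin.prod_univ_succ]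
  have h2 : ∀ i : Fin m, i.succ.succ ≠ 1 := fun i hi => by
    rw [← Fin.succ_zero_eq_one] at hi
    exact Fin.succ_ne_zero i (Fin.succ_injective _ hi)
  simp [Fin.succ_ne_zero, h2]

theorem sum_compoundDifferential_single_zero_one (m : ℕ) :
    ∑ s, ∑ t, compoundDifferential
      (Matrix.single 0 1 1 : Matrix (Fin (m + 2)) (Fin (m + 2)) ℂ) s t = 2 ^ m := by
  have h : ∀ s, ∑ t, compoundDifferential
      (Matrix.single 0 1 1 : Matrix (Fin (m + 2)) (Fin (m + 2)) ℂ) s t =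
      if s 0 = 1 ∧ s 1 = 0 then 1 else 0 := by
    intro s
    simp only [compoundDifferential_single_zero_one]
    split_ifs
    · simp [Matrix.one_apply]
    · simp
  simp only [h]
  rw [Finset.sum_boole, card_filter_zero_one]
  simp

theorem sum_compoundDifferential_hop (m : ℕ) :
    ∑ s, ∑ t, compoundDifferential
      (Matrix.single 0 1 1 + Matrix.single 1 0 1 : Matrix (Fin (m + 2)) (Fin (m + 2)) ℂ) s t =
      2 * 2 ^ m := by
  have h : (Matrix.single 1 0 1 : Matrix (Fin (m + 2)) (Fin (m + 2)) ℂ) =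
      (Matrix.single 0 1 1).transpose := by simp
  rw [h, compoundDifferential_add, compoundDifferential_transpose]
  simp only [Matrix.add_apply, Matrix.transpose_apply, Finset.sum_add_distrib]
  rw [Finset.sum_comm (f := fun s t => compoundDifferential
    (Matrix.single 0 1 1 : Matrix (Fin (m + 2)) (Fin (m + 2)) ℂ) t s),
    sum_compoundDifferential_single_zero_one]
  ring

/-! ### Haar probability measure on a compact group. -/

section HaarProb

variable (G : Type*) [Group G] [TopologicalSpace G] [IsTopologicalGroup G]
    [CompactSpace G] [MeasurableSpace G] [BorelSpace G]

instance isHaarMeasure_haarProb : (haarProb G).IsHaarMeasure :=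
  Measure.isHaarMeasure_haarMeasure _

instance isProbabilityMeasure_haarProb : IsProbabilityMeasure (haarProb G) :=
  ⟨by
    have := Measure.haarMeasure_self (G := G) (K₀ := ⊤)
    simpa [haarProb] using this⟩

/-- A right translate of the measure is again a Haar probability measure, and there is only one. -/
instance isMulRightInvariant_haarProb : (haarProb G).IsMulRightInvariant where
  map_mul_right_eq_self g := by
    have h1 : (Measure.map (· * g) (haarProb G)).IsHaarMeasure :=
      Measure.isHaarMeasure_map_mul_right _ g
    have h2 : IsProbabilityMeasure (Measure.map (· * g) (haarProb G)) :=
      Measure.isProbabilityMeasure_map (measurable_mul_const g).aemeasurable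
    exact Measure.isHaarMeasure_eq_of_isProbabilityMeasure _ _

variable {G}

theorem Continuous.integrable_haarProb {f : G → ℝ} (hf : Continuous f) :
    Integrable f (haarProb G) :=
  hf.integrable_of_hasCompactSupport (HasCompactSupport.of_compactSpace f)

end HaarProb

/-! ### Invariance of the squared moduli of the entries. -/

section Unitary

variable {n : ℕ} {𝕜 : Type*} [RCLike 𝕜]

/-- Makes the Borel sigma-algebra of a product of two copies agree with the product sigma-algebra,
so that continuous functions of `(g₊, g₋)` are measurable. -/
instance secondCountableTopology_specialUnitaryGroup :
    SecondCountableTopology (Matrix.specialUnitaryGroup (Fin n) 𝕜) :=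
  have : SecondCountableTopology (Matrix (Fin n) (Fin n) 𝕜) :=
    inferInstanceAs (SecondCountableTopology (Fin n → Fin n → 𝕜))
  TopologicalSpace.Subtype.secondCountableTopology _

theorem continuous_entry (i j : Fin n) :
    Continuous fun g : Matrix.specialUnitaryGroup (Fin n) 𝕜 => (g : Matrix _ _ 𝕜) i j :=
  continuous_subtype_val.matrix_elem i j

/-- A diagonal correction that makes the determinant of a unitary matrix equal to `1`. -/
theorem exists_diagonal_mem_specialUnitaryGroup [NeZero n] {u : Matrix (Fin n) (Fin n) 𝕜}
    (hu : u ∈ Matrix.unitaryGroup (Fin n) 𝕜) :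
    ∃ d : Fin n → 𝕜, (∀ i, ‖d i‖ = 1) ∧
      u * Matrix.diagonal d ∈ Matrix.specialUnitaryGroup (Fin n) 𝕜 ∧
      Matrix.diagonal d * u ∈ Matrix.specialUnitaryGroup (Fin n) 𝕜 := by
  have hdet : star u.det * u.det = 1 := by
    rw [← Matrix.det_conjTranspose, ← Matrix.det_mul, ← Matrix.star_eq_conjTranspose,
      Matrix.mem_unitaryGroup_iff'.1 hu, Matrix.det_one]
  have hn : ‖u.det‖ = 1 := by
    have h1 := congrArg norm hdet
    rw [norm_mul, norm_star, norm_one] at h1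
    nlinarith [norm_nonneg u.det]
  let d : Fin n → 𝕜 := Function.update 1 0 (star u.det)
  have hd : ∀ i, ‖d i‖ = 1 := by
    intro i
    by_cases hi : i = 0
    · subst hi; simp [d, hn]
    · simp [d, hi]
  have hdd : Matrix.diagonal d ∈ Matrix.unitaryGroup (Fin n) 𝕜 := by
    rw [Matrix.mem_unitaryGroup_iff, Matrix.star_eq_conjTranspose, Matrix.diagonal_conjTranspose,
      Matrix.diagonal_mul_diagonal, ← Matrix.diagonal_one]
    congr 1
    funext i
    rw [Pi.star_apply, RCLike.star_def, RCLike.mul_conj, hd i]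
    simp
  have hprod : (Matrix.diagonal d).det = star u.det := by
    rw [Matrix.det_diagonal, Finset.prod_update_of_mem (Finset.mem_univ _)]
    simp
  refine ⟨d, hd, ?_, ?_⟩
  · rw [Matrix.mem_specialUnitaryGroup_iff, Matrix.det_mul, hprod, mul_comm, hdet]
    exact ⟨mul_mem hu hdd, rfl⟩
  · rw [Matrix.mem_specialUnitaryGroup_iff, Matrix.det_mul, hprod, hdet]
    exact ⟨mul_mem hdd hu, rfl⟩

/-- The squared moduli of the entries. -/
def entrySq (A : Matrix (Fin n) (Fin n) 𝕜) : Fin n → Fin n → ℝ := fun i j => ‖A i j‖ ^ 2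

/-- The determinant of `u` is corrected by a diagonal of phases on the right, which only rescales
columns by phases and is invisible to moduli. Thus arbitrary unitaries, including odd permutations
and eigenvector matrices, act as if they were in the group. -/
theorem integral_entrySq_mul_right [NeZero n] {u : Matrix (Fin n) (Fin n) 𝕜}
    (hu : u ∈ Matrix.unitaryGroup (Fin n) 𝕜) (F : (Fin n → Fin n → ℝ) → ℝ) :
    ∫ g : Matrix.specialUnitaryGroup (Fin n) 𝕜, F (entrySq ((g : Matrix _ _ 𝕜) * u))
        ∂haarProb _ =
      ∫ g : Matrix.specialUnitaryGroup (Fin n) 𝕜, F (entrySq (g : Matrix _ _ 𝕜)) ∂haarProb _ := by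
  obtain ⟨d, hd, hmem, -⟩ := exists_diagonal_mem_specialUnitaryGroup hu
  rw [← integral_mul_right_eq_self (fun g : Matrix.specialUnitaryGroup (Fin n) 𝕜 =>
    F (entrySq (g : Matrix _ _ 𝕜))) ⟨_, hmem⟩]
  refine integral_congr_ae (Filter.Eventually.of_forall fun g => ?_)
  refine congrArg F (funext fun i => funext fun j => ?_)
  rw [entrySq, entrySq, Submonoid.coe_mul, ← mul_assoc, Matrix.mul_diagonal, norm_mul, hd, mul_one]

theorem integral_entrySq_mul_left [NeZero n] {u : Matrix (Fin n) (Fin n) 𝕜}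
    (hu : u ∈ Matrix.unitaryGroup (Fin n) 𝕜) (F : (Fin n → Fin n → ℝ) → ℝ) :
    ∫ g : Matrix.specialUnitaryGroup (Fin n) 𝕜, F (entrySq (u * (g : Matrix _ _ 𝕜)))
        ∂haarProb _ =
      ∫ g : Matrix.specialUnitaryGroup (Fin n) 𝕜, F (entrySq (g : Matrix _ _ 𝕜)) ∂haarProb _ := by
  obtain ⟨d, hd, -, hmem⟩ := exists_diagonal_mem_specialUnitaryGroup hu
  rw [← integral_mul_left_eq_self (fun g : Matrix.specialUnitaryGroup (Fin n) 𝕜 =>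
    F (entrySq (g : Matrix _ _ 𝕜))) ⟨_, hmem⟩]
  refine integral_congr_ae (Filter.Eventually.of_forall fun g => ?_)
  refine congrArg F (funext fun i => funext fun j => ?_)
  rw [entrySq, entrySq, Submonoid.coe_mul, mul_assoc, Matrix.diagonal_mul, norm_mul, hd, one_mul]

theorem permMatrix_mem_unitaryGroup (σ : Equiv.Perm (Fin n)) :
    σ.permMatrix 𝕜 ∈ Matrix.unitaryGroup (Fin n) 𝕜 := by
  rw [Matrix.mem_unitaryGroup_iff, Matrix.star_eq_conjTranspose, Matrix.conjTranspose_permMatrix,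
    ← Matrix.permMatrix_mul]
  simp

theorem integral_entrySq_perm_row [NeZero n] (σ : Equiv.Perm (Fin n))
    (F : (Fin n → Fin n → ℝ) → ℝ) :
    ∫ g : Matrix.specialUnitaryGroup (Fin n) 𝕜,
        F (fun i j => entrySq (g : Matrix _ _ 𝕜) (σ i) j) ∂haarProb _ =
      ∫ g : Matrix.specialUnitaryGroup (Fin n) 𝕜, F (entrySq (g : Matrix _ _ 𝕜)) ∂haarProb _ := by
  rw [← integral_entrySq_mul_left (permMatrix_mem_unitaryGroup σ) F]
  refine integral_congr_ae (Filter.Eventually.of_forall fun g => ?_)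
  refine congrArg F (funext fun i => funext fun j => ?_)
  rw [entrySq, entrySq, Equiv.Perm.permMatrix, PEquiv.toMatrix_toPEquiv_mul]
  rfl

theorem integral_entrySq_perm_col [NeZero n] (σ : Equiv.Perm (Fin n))
    (F : (Fin n → Fin n → ℝ) → ℝ) :
    ∫ g : Matrix.specialUnitaryGroup (Fin n) 𝕜,
        F (fun i j => entrySq (g : Matrix _ _ 𝕜) i (σ j)) ∂haarProb _ =
      ∫ g : Matrix.specialUnitaryGroup (Fin n) 𝕜, F (entrySq (g : Matrix _ _ 𝕜)) ∂haarProb _ := by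
  rw [← integral_entrySq_mul_right (permMatrix_mem_unitaryGroup σ.symm) F]
  refine integral_congr_ae (Filter.Eventually.of_forall fun g => ?_)
  refine congrArg F (funext fun i => funext fun j => ?_)
  rw [entrySq, entrySq, Equiv.Perm.permMatrix, PEquiv.mul_toMatrix_toPEquiv]
  rfl

theorem sum_entrySq_row (g : Matrix.specialUnitaryGroup (Fin n) 𝕜) (i : Fin n) :
    ∑ j, entrySq (g : Matrix _ _ 𝕜) i j = 1 := by
  have h := congrFun (congrFun (Matrix.mem_unitaryGroup_iff.1
    (Matrix.mem_specialUnitaryGroup_iff.1 g.2).1) i) i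
  rw [Matrix.mul_apply, Matrix.one_apply_eq] at h
  have h2 := congrArg RCLike.re h
  rw [map_sum, RCLike.one_re] at h2
  rw [← h2]
  refine Finset.sum_congr rfl fun j _ => ?_
  rw [Matrix.star_apply, RCLike.star_def, RCLike.mul_conj, entrySq, ← RCLike.ofReal_pow,
    RCLike.ofReal_re]

theorem sum_entrySq_col (g : Matrix.specialUnitaryGroup (Fin n) 𝕜) (j : Fin n) :
    ∑ i, entrySq (g : Matrix _ _ 𝕜) i j = 1 := by
  have h := congrFun (congrFun (Matrix.mem_unitaryGroup_iff'.1
    (Matrix.mem_specialUnitaryGroup_iff.1 g.2).1) j) j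
  rw [Matrix.mul_apply, Matrix.one_apply_eq] at h
  have h2 := congrArg RCLike.re h
  rw [map_sum, RCLike.one_re] at h2
  rw [← h2]
  refine Finset.sum_congr rfl fun i _ => ?_
  rw [Matrix.star_apply, RCLike.star_def, RCLike.conj_mul, entrySq, ← RCLike.ofReal_pow,
    RCLike.ofReal_re]

theorem continuous_entrySq (i j : Fin n) :
    Continuous fun g : Matrix.specialUnitaryGroup (Fin n) 𝕜 => entrySq (g : Matrix _ _ 𝕜) i j :=
  (continuous_entry i j).norm.pow 2

/-! ### Second moments of the squared moduli. -/

/-- The unitary matrix that mixes the coordinates `a` and `b` with equal weights, after the phase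
`w` on `b`. -/
noncomputable def mixingMatrix {n : ℕ} {𝕜 : Type*} [RCLike 𝕜] (a b : Fin n) (w : 𝕜) :
    Matrix (Fin n) (Fin n) 𝕜 :=
  Matrix.diagonal (Function.update 1 b w) *
    (1 + (((√2)⁻¹ - 1 : ℝ) : 𝕜) • Matrix.single a a 1 + (((√2)⁻¹ : ℝ) : 𝕜) • Matrix.single a b 1 +
      (((√2)⁻¹ : ℝ) : 𝕜) • Matrix.single b a 1 + ((-(√2)⁻¹ - 1 : ℝ) : 𝕜) • Matrix.single b b 1)

section Moments

variable {n : ℕ} {𝕜 : Type*} [RCLike 𝕜]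

theorem mixingMatrix_mem {a b : Fin n} (hab : a ≠ b) {w : 𝕜} (hw : ‖w‖ = 1) :
    mixingMatrix a b w ∈ Matrix.unitaryGroup (Fin n) 𝕜 := by
  refine mul_mem ?_ ?_
  · rw [Matrix.mem_unitaryGroup_iff, Matrix.star_eq_conjTranspose, Matrix.diagonal_conjTranspose,
      Matrix.diagonal_mul_diagonal, ← Matrix.diagonal_one]
    congr 1
    funext i
    rw [Pi.star_apply, RCLike.star_def, RCLike.mul_conj]
    by_cases hi : i = b
    · subst hi; simp [hw]
    · simp [hi]
  · rw [Matrix.mem_unitaryGroup_iff]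
    have hs : (√2)⁻¹ * (√2)⁻¹ = (1 / 2 : ℝ) := by
      rw [← mul_inv, Real.mul_self_sqrt (by norm_num)]; norm_num
    set s : ℝ := (√2)⁻¹
    have hs' : (s : 𝕜) * s = 1 / 2 := by
      rw [← RCLike.ofReal_mul, hs, RCLike.ofReal_div, RCLike.ofReal_one, RCLike.ofReal_ofNat]
    simp only [Matrix.star_eq_conjTranspose, Matrix.conjTranspose_add, Matrix.conjTranspose_one,
      Matrix.conjTranspose_smul, Matrix.conjTranspose_single, star_one, RCLike.star_def,
      RCLike.conj_ofReal, mul_add, add_mul, mul_one, one_mul, smul_mul_smul_comm,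
      Matrix.single_mul_single_same, Matrix.single_mul_single_of_ne _ _ _ _ hab,
      Matrix.single_mul_single_of_ne _ _ _ _ hab.symm, smul_zero, map_sub, map_neg, map_one]
    linear_combination (norm := module) (2 * hs') • (Matrix.single a a (1 : 𝕜)) +
      (2 * hs') • (Matrix.single b b (1 : 𝕜))

theorem mul_mixingMatrix_left {a b : Fin n} (hab : a ≠ b) (w : 𝕜) (g : Matrix (Fin n) (Fin n) 𝕜)
    (r : Fin n) :
    (g * mixingMatrix a b w) r a = (((√2)⁻¹ : ℝ) : 𝕜) * (g r a + w * g r b) := by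
  simp only [mixingMatrix, ← mul_assoc, mul_add, Matrix.add_apply, mul_one, Matrix.mul_smul,
    Matrix.smul_apply,
    Matrix.mul_single_apply_same, Matrix.mul_single_apply_of_ne _ _ _ _ _ hab, Matrix.mul_diagonal]
  simp [hab]
  ring

theorem mul_mixingMatrix_right {a b : Fin n} (hab : a ≠ b) (w : 𝕜) (g : Matrix (Fin n) (Fin n) 𝕜)
    (r : Fin n) :
    (g * mixingMatrix a b w) r b = (((√2)⁻¹ : ℝ) : 𝕜) * (g r a - w * g r b) := by
  simp only [mixingMatrix, ← mul_assoc, mul_add, Matrix.add_apply, mul_one, Matrix.mul_smul,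
    Matrix.smul_apply,
    Matrix.mul_single_apply_same, Matrix.mul_single_apply_of_ne _ _ _ _ _ hab.symm,
    Matrix.mul_diagonal]
  simp [hab]
  ring

/-- The real part of `x * conj (w * y)`. -/
def crossTerm (w x y : 𝕜) : ℝ :=
  RCLike.re x * RCLike.re (w * y) + RCLike.im x * RCLike.im (w * y)

/-- With `z = wy`, the values `|x ± z|²` are `|x|² + |z|² ± 2 Re(x z̄)`; in the sum of their squares
the terms linear in the cross term cancel. -/
theorem norm_mix_pow_four (w x y : 𝕜) (hw : ‖w‖ = 1) :
    (‖(((√2)⁻¹ : ℝ) : 𝕜) * (x + w * y)‖ ^ 2) ^ 2 + (‖(((√2)⁻¹ : ℝ) : 𝕜) * (x - w * y)‖ ^ 2) ^ 2 =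
      (‖x‖ ^ 2 * ‖x‖ ^ 2 + ‖y‖ ^ 2 * ‖y‖ ^ 2) / 2 + ‖x‖ ^ 2 * ‖y‖ ^ 2 + 2 * crossTerm w x y ^ 2 := by
  have hs : ‖(((√2)⁻¹ : ℝ) : 𝕜)‖ ^ 2 = (1 / 2 : ℝ) := by
    rw [RCLike.norm_ofReal, sq_abs, inv_pow, Real.sq_sqrt (by norm_num)]; norm_num
  have hv : ∀ v : 𝕜, ‖(((√2)⁻¹ : ℝ) : 𝕜) * v‖ ^ 2 = 1 / 2 * ‖v‖ ^ 2 := fun v => by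
    rw [norm_mul, mul_pow, hs]
  have hy : ‖y‖ ^ 2 = ‖w * y‖ ^ 2 := by rw [norm_mul, hw, one_mul]
  rw [hv, hv, hy]
  unfold crossTerm
  generalize w * y = z
  simp only [RCLike.norm_sq_eq_def, map_add, map_sub]
  ring

/-- Over `ℂ` take `w = i`: the two cross terms are, up to sign, the real and imaginary parts of `x
ȳ`, and equality holds. Over `ℝ` the choice `w = 1` already makes each square equal to the left
side. -/
theorem exists_crossTerm (𝕜 : Type*) [RCLike 𝕜] : ∃ w : 𝕜, ‖w‖ = 1 ∧ ∀ x y : 𝕜,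
    ‖x‖ ^ 2 * ‖y‖ ^ 2 ≤ crossTerm 1 x y ^ 2 + crossTerm w x y ^ 2 := by
  rcases RCLike.I_eq_zero_or_im_I_eq_one (K := 𝕜) with h | h
  · have him : ∀ z : 𝕜, RCLike.im z = 0 := fun z => by
      rw [← RCLike.re_add_im z, h]; simp
    refine ⟨1, norm_one, fun x y => ?_⟩
    simp only [crossTerm, RCLike.norm_sq_eq_def, him, one_mul]
    nlinarith [sq_nonneg (RCLike.re x * RCLike.re y)]
  · refine ⟨RCLike.I, ?_, fun x y => ?_⟩
    · exact RCLike.norm_I_of_ne_zero fun h0 => by simp [h0] at h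
    · simp only [crossTerm, RCLike.norm_sq_eq_def, one_mul, RCLike.mul_re, RCLike.mul_im,
        RCLike.I_re, h]
      apply le_of_eq
      ring

variable (𝕜) in
/-- The second moments of the squared moduli of the entries of a random group element. -/
noncomputable def entryMoment (i j k l : Fin n) : ℝ :=
  ∫ g : Matrix.specialUnitaryGroup (Fin n) 𝕜,
    entrySq (g : Matrix _ _ 𝕜) i j * entrySq (g : Matrix _ _ 𝕜) k l ∂haarProb _

theorem entryMoment_perm [NeZero n] (σ τ : Equiv.Perm (Fin n)) (i j k l : Fin n) :
    entryMoment 𝕜 (σ i) (τ j) (σ k) (τ l) = entryMoment 𝕜 i j k l := by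
  unfold entryMoment
  rw [← integral_entrySq_perm_row σ fun p => p i j * p k l,
    ← integral_entrySq_perm_col τ fun p => p (σ i) j * p (σ k) l]

theorem integrable_entrySq_mul (i j k l : Fin n) :
    Integrable (fun g : Matrix.specialUnitaryGroup (Fin n) 𝕜 =>
      entrySq (g : Matrix _ _ 𝕜) i j * entrySq (g : Matrix _ _ 𝕜) k l) (haarProb _) :=
  ((continuous_entrySq i j).mul (continuous_entrySq k l)).integrable_haarProb

theorem integral_entrySq [NeZero n] (i j : Fin n) :
    ∫ g : Matrix.specialUnitaryGroup (Fin n) 𝕜, entrySq (g : Matrix _ _ 𝕜) i j ∂haarProb _ =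
      1 / n := by
  have h : ∀ k, ∫ g : Matrix.specialUnitaryGroup (Fin n) 𝕜, entrySq (g : Matrix _ _ 𝕜) i k
      ∂haarProb _ = ∫ g : Matrix.specialUnitaryGroup (Fin n) 𝕜, entrySq (g : Matrix _ _ 𝕜) i j
      ∂haarProb _ := by
    intro k
    rw [← integral_entrySq_perm_col (Equiv.swap j k) fun p => p i j]
    simp
  have hsum : ∑ k, ∫ g : Matrix.specialUnitaryGroup (Fin n) 𝕜, entrySq (g : Matrix _ _ 𝕜) i k
      ∂haarProb _ = 1 := by
    rw [← integral_finsetSum _ fun k _ => (continuous_entrySq i k).integrable_haarProb]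
    simp [sum_entrySq_row]
  simp only [h, Finset.sum_const, Finset.card_univ, Fintype.card_fin, nsmul_eq_mul] at hsum
  have hn : (n : ℝ) ≠ 0 := Nat.cast_ne_zero.2 (NeZero.ne n)
  field_simp
  linarith

theorem sum_entryMoment_row [NeZero n] (i j k : Fin n) :
    ∑ l, entryMoment 𝕜 i j k l = 1 / n := by
  unfold entryMoment
  rw [← integral_finsetSum _ fun l _ => integrable_entrySq_mul i j k l]
  simp only [← Finset.mul_sum, sum_entrySq_row, mul_one, integral_entrySq]

theorem sum_entryMoment_col [NeZero n] (i j l : Fin n) :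
    ∑ k, entryMoment 𝕜 i j k l = 1 / n := by
  unfold entryMoment
  rw [← integral_finsetSum _ fun k _ => integrable_entrySq_mul i j k l]
  simp only [← Finset.mul_sum, sum_entrySq_col, mul_one, integral_entrySq]

theorem entryMoment_self [NeZero n] (i j k l : Fin n) :
    entryMoment 𝕜 i j i j = entryMoment 𝕜 k l k l := by
  have := entryMoment_perm (𝕜 := 𝕜) (Equiv.swap i k) (Equiv.swap j l) i j i j
  simpa using this.symm

theorem continuous_crossTerm (w : 𝕜) (r a b : Fin n) :
    Continuous fun g : Matrix.specialUnitaryGroup (Fin n) 𝕜 =>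
      crossTerm w ((g : Matrix _ _ 𝕜) r a) ((g : Matrix _ _ 𝕜) r b) := by
  have h1 := continuous_entry (𝕜 := 𝕜) r a
  have h2 := continuous_entry (𝕜 := 𝕜) r b
  have h3 := continuous_const (y := w).mul h2
  exact ((RCLike.continuous_re.comp h1).mul (RCLike.continuous_re.comp h3)).add
    ((RCLike.continuous_im.comp h1).mul (RCLike.continuous_im.comp h3))

theorem integrable_crossTerm_sq (w : 𝕜) (r a b : Fin n) :
    Integrable (fun g : Matrix.specialUnitaryGroup (Fin n) 𝕜 =>
      crossTerm w ((g : Matrix _ _ 𝕜) r a) ((g : Matrix _ _ 𝕜) r b) ^ 2) (haarProb _) :=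
  ((continuous_crossTerm w r a b).pow 2).integrable_haarProb

theorem integral_mean_add {X : Type*} [MeasurableSpace X] {μ : Measure X} {f g h k : X → ℝ}
    (hf : Integrable f μ) (hg : Integrable g μ) (hh : Integrable h μ) (hk : Integrable k μ) :
    ∫ x, ((f x + g x) / 2 + h x + 2 * k x) ∂μ =
      (∫ x, f x ∂μ + ∫ x, g x ∂μ) / 2 + ∫ x, h x ∂μ + 2 * ∫ x, k x ∂μ := by
  rw [integral_add (f := fun x => (f x + g x) / 2 + h x) (g := fun x => 2 * k x)
      (((hf.add hg).div_const 2).add hh) (hk.const_mul 2),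
    integral_add (f := fun x => (f x + g x) / 2) ((hf.add hg).div_const 2) hh, integral_div,
    integral_add hf hg, integral_const_mul]

/-- The fourth moment in terms of the rotated entries. -/
theorem entryMoment_self_eq [NeZero n] {a b : Fin n} (hab : a ≠ b) (r : Fin n) {w : 𝕜}
    (hw : ‖w‖ = 1) :
    entryMoment 𝕜 r a r a = entryMoment 𝕜 r a r b +
      2 * ∫ g : Matrix.specialUnitaryGroup (Fin n) 𝕜,
        crossTerm w ((g : Matrix _ _ 𝕜) r a) ((g : Matrix _ _ 𝕜) r b) ^ 2 ∂haarProb _ := by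
  have h1 := integral_entrySq_mul_right (mixingMatrix_mem hab hw)
    fun p => p r a ^ 2 + p r b ^ 2
  have h2 : ∀ g : Matrix.specialUnitaryGroup (Fin n) 𝕜,
      entrySq ((g : Matrix _ _ 𝕜) * mixingMatrix a b w) r a ^ 2 +
        entrySq ((g : Matrix _ _ 𝕜) * mixingMatrix a b w) r b ^ 2 =
      (entrySq (g : Matrix _ _ 𝕜) r a * entrySq (g : Matrix _ _ 𝕜) r a +
        entrySq (g : Matrix _ _ 𝕜) r b * entrySq (g : Matrix _ _ 𝕜) r b) / 2 +
        entrySq (g : Matrix _ _ 𝕜) r a * entrySq (g : Matrix _ _ 𝕜) r b +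
        2 * crossTerm w ((g : Matrix _ _ 𝕜) r a) ((g : Matrix _ _ 𝕜) r b) ^ 2 := by
    intro g
    simp only [entrySq, mul_mixingMatrix_left hab, mul_mixingMatrix_right hab]
    exact norm_mix_pow_four w _ _ hw
  simp only [h2] at h1
  have ia := integrable_entrySq_mul (𝕜 := 𝕜) r a r a
  have ib := integrable_entrySq_mul (𝕜 := 𝕜) r b r b
  have iab := integrable_entrySq_mul (𝕜 := 𝕜) r a r b
  have ic := integrable_crossTerm_sq w r a b
  rw [integral_mean_add ia ib iab ic] at h1
  simp only [sq (entrySq _ _ _)] at h1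
  rw [integral_add ia ib] at h1
  have h3 := entryMoment_self (𝕜 := 𝕜) r b r a
  unfold entryMoment at *
  linarith

/-- Averaging `entryMoment_self_eq` over the phases `1` and `w` makes the two cross-term integrals
add up to at least the mixed moment. This is the only input on the moments beyond permutation
symmetry and normalisation. -/
theorem two_mul_entryMoment_le [NeZero n] {a b : Fin n} (hab : a ≠ b) (r : Fin n) :
    2 * entryMoment 𝕜 r a r b ≤ entryMoment 𝕜 r a r a := by
  obtain ⟨w, hw, hx⟩ := exists_crossTerm 𝕜
  have h1 := entryMoment_self_eq hab r (norm_one (α := 𝕜))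
  have h2 := entryMoment_self_eq hab r hw
  have i1 := integrable_crossTerm_sq (1 : 𝕜) r a b
  have i2 := integrable_crossTerm_sq w r a b
  have h3 : entryMoment 𝕜 r a r b ≤ ∫ g : Matrix.specialUnitaryGroup (Fin n) 𝕜,
      (crossTerm 1 ((g : Matrix _ _ 𝕜) r a) ((g : Matrix _ _ 𝕜) r b) ^ 2 +
      crossTerm w ((g : Matrix _ _ 𝕜) r a) ((g : Matrix _ _ 𝕜) r b) ^ 2) ∂haarProb _ :=
    integral_mono (integrable_entrySq_mul r a r b) (i1.add i2) fun g => hx _ _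
  rw [integral_add i1 i2] at h3
  linarith

theorem exists_perm_pair {α : Type*} [DecidableEq α] {x y x' y' : α} (h : x ≠ y) (h' : x' ≠ y') :
    ∃ σ : Equiv.Perm α, σ x = x' ∧ σ y = y' := by
  refine ⟨Equiv.swap (Equiv.swap x x' y) y' * Equiv.swap x x', ?_, ?_⟩
  · rw [Equiv.Perm.mul_apply, Equiv.swap_apply_left, Equiv.swap_apply_of_ne_of_ne _ h']
    intro h2
    rw [eq_comm, Equiv.swap_apply_eq_iff, Equiv.swap_apply_right] at h2
    exact h h2.symm
  · rw [Equiv.Perm.mul_apply, Equiv.swap_apply_left]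

theorem integral_bilinear_entrySq [NeZero n] {α β : Fin n → ℝ} :
    ∫ g : Matrix.specialUnitaryGroup (Fin n) 𝕜,
      (∑ i, ∑ j, β i * α j * entrySq (g : Matrix _ _ 𝕜) i j) ∂haarProb _ =
      (∑ i, β i) * (∑ j, α j) / n := by
  have hi : ∀ i j, Integrable (fun g : Matrix.specialUnitaryGroup (Fin n) 𝕜 =>
      β i * α j * entrySq (g : Matrix _ _ 𝕜) i j) (haarProb _) := fun i j =>
    ((continuous_entrySq i j).integrable_haarProb).const_mul _
  rw [integral_finsetSum _ fun i _ => integrable_finsetSum _ fun j _ => hi i j]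
  simp only [integral_finsetSum _ fun j _ => hi _ j, integral_const_mul, integral_entrySq]
  rw [Finset.sum_mul_sum, Finset.sum_div]
  refine Finset.sum_congr rfl fun i _ => ?_
  rw [Finset.sum_div]
  exact Finset.sum_congr rfl fun j _ => by ring

end Moments

/-! ### Second moment of centred bilinear forms in the squared moduli. -/

section SecondMoment

variable {n : ℕ} {𝕜 : Type*} [RCLike 𝕜]

/-- Row and column permutations leave four values: `a` (same entry), `br` (same row), `bc` (same
column), `c` (neither). They are written in inclusion–exclusion form, because centring will later
kill every term except the last. -/
theorem exists_entryMoment_eq (hn : 2 ≤ n) : ∃ c br bc e : ℝ, 1 / (n * (n + 1)) ≤ e ∧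
    ∀ i j k l : Fin n, entryMoment 𝕜 i j k l =
      c + (if i = k then br else 0) + (if j = l then bc else 0) +
        (if i = k then if j = l then e else 0 else 0) := by
  have : NeZero n := ⟨by omega⟩
  let o : Fin n := ⟨0, by omega⟩
  let p : Fin n := ⟨1, by omega⟩
  have hop : o ≠ p := by simp [o, p, Fin.ext_iff]
  set a := entryMoment 𝕜 o o o o with ha
  set br := entryMoment 𝕜 o o o p with hbr
  set bc := entryMoment 𝕜 o o p o with hbc
  set c := entryMoment 𝕜 o o p p with hc
  have key : ∀ i j k l : Fin n, entryMoment 𝕜 i j k l =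
      if i = k then if j = l then a else br else if j = l then bc else c := by
    intro i j k l
    split_ifs with hik hjl hjl
    · subst hik; subst hjl
      exact entryMoment_self _ _ _ _
    · subst hik
      obtain ⟨τ, rfl, rfl⟩ := exists_perm_pair hop hjl
      have := entryMoment_perm (𝕜 := 𝕜) (Equiv.swap o i) τ o o o p
      rwa [Equiv.swap_apply_left] at this
    · subst hjl
      obtain ⟨σ, rfl, rfl⟩ := exists_perm_pair hop hik
      have := entryMoment_perm (𝕜 := 𝕜) σ (Equiv.swap o j) o o p o
      rwa [Equiv.swap_apply_left] at this
    · obtain ⟨σ, rfl, rfl⟩ := exists_perm_pair hop hik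
      obtain ⟨τ, rfl, rfl⟩ := exists_perm_pair hop hjl
      exact entryMoment_perm σ τ o o p p
  have hsum : ∀ x y : ℝ, ∑ l : Fin n, (if o = l then x else y) = x + (n - 1) * y := by
    intro x y
    have : ∀ l : Fin n, (if o = l then x else y) = y + if o = l then x - y else 0 := fun l => by
      split_ifs <;> ring
    simp only [this, Finset.sum_add_distrib, Finset.sum_const, Finset.card_univ, Fintype.card_fin,
      nsmul_eq_mul, Finset.sum_ite_eq, Finset.mem_univ, if_true]
    ring
  have h1 : a + (n - 1) * br = 1 / n := by
    rw [← sum_entryMoment_row (𝕜 := 𝕜) o o o, ← hsum]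
    exact Finset.sum_congr rfl fun l _ => by rw [key, if_pos rfl]
  have h2 : bc + (n - 1) * c = 1 / n := by
    rw [← sum_entryMoment_row (𝕜 := 𝕜) o o p, ← hsum]
    exact Finset.sum_congr rfl fun l _ => by rw [key, if_neg hop]
  have h3 : a + (n - 1) * bc = 1 / n := by
    rw [← sum_entryMoment_col (𝕜 := 𝕜) o o o, ← hsum]
    refine Finset.sum_congr rfl fun l _ => ?_
    rw [key]
    simp
  have h4 : 2 * br ≤ a := two_mul_entryMoment_le hop o
  have hn' : (2 : ℝ) ≤ n := by exact_mod_cast hn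
  refine ⟨c, br - c, bc - c, a - br - bc + c, ?_, fun i j k l => ?_⟩
  · have h5 : br = bc := mul_left_cancel₀ (show (n - 1 : ℝ) ≠ 0 by linarith) (by linarith)
    rw [← h5] at h2 ⊢
    have h6 : (n - 1) * (c - br) = a - br := by linarith
    have h7 : (n : ℝ) * a + n * (n - 1) * br = 1 := by
      have := congrArg (fun x => (n : ℝ) * x) h1
      simp only [mul_one_div_cancel (show (n : ℝ) ≠ 0 by linarith)] at this
      linarith
    -- By `h7`, the difference of the two sides is `n² (a - 2 br)`. Since `e = (a - br) + (c - br)`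
    -- once `br = bc`, and `c ≥ br`, this already bounds `e`.
    have h8 : 1 ≤ (a - br) * (n * (n + 1)) := by
      nlinarith [mul_nonneg (sq_nonneg (n : ℝ)) (sub_nonneg.2 h4)]
    have h9 : 0 ≤ a - br := by
      by_contra! h
      nlinarith [mul_pos (show (0 : ℝ) < n by linarith) (show (0 : ℝ) < n + 1 by linarith)]
    have h10 : 0 ≤ c - br := by
      by_contra! h
      nlinarith
    rw [div_le_iff₀ (by positivity)]
    nlinarith [mul_nonneg h10 (show (0 : ℝ) ≤ n * (n + 1) by positivity)]
  · rw [key]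
    split_ifs <;> ring

/-- The second moment of a centred bilinear form in the squared moduli of the entries. -/
theorem exists_integral_bilinear_entrySq_sq (𝕜 : Type*) [RCLike 𝕜] (hn : 2 ≤ n) :
    ∃ e : ℝ, 1 / (n * (n + 1)) ≤ e ∧ ∀ α β : Fin n → ℝ, ∑ i, α i = 0 → ∑ i, β i = 0 →
      ∫ g : Matrix.specialUnitaryGroup (Fin n) 𝕜,
        (∑ i, ∑ j, β i * α j * entrySq (g : Matrix _ _ 𝕜) i j) ^ 2 ∂haarProb _ =
      e * (∑ i, β i ^ 2) * (∑ j, α j ^ 2) := by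
  obtain ⟨c, br, bc, e, he, key⟩ := exists_entryMoment_eq (𝕜 := 𝕜) hn
  refine ⟨e, he, fun α β hα hβ => ?_⟩
  have hi : ∀ i j k l, Integrable (fun g : Matrix.specialUnitaryGroup (Fin n) 𝕜 =>
      β i * α j * (β k * α l) *
        (entrySq (g : Matrix _ _ 𝕜) i j * entrySq (g : Matrix _ _ 𝕜) k l)) (haarProb _) :=
    fun i j k l => (integrable_entrySq_mul i j k l).const_mul _
  have h1 : ∀ g : Matrix.specialUnitaryGroup (Fin n) 𝕜,
      (∑ i, ∑ j, β i * α j * entrySq (g : Matrix _ _ 𝕜) i j) ^ 2 =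
      ∑ i, ∑ j, ∑ k, ∑ l, β i * α j * (β k * α l) *
        (entrySq (g : Matrix _ _ 𝕜) i j * entrySq (g : Matrix _ _ 𝕜) k l) := by
    intro g
    rw [sq, Finset.sum_mul]
    refine Finset.sum_congr rfl fun i _ => ?_
    rw [Finset.sum_mul]
    refine Finset.sum_congr rfl fun j _ => ?_
    rw [Finset.mul_sum]
    refine Finset.sum_congr rfl fun k _ => ?_
    rw [Finset.mul_sum]
    exact Finset.sum_congr rfl fun l _ => by ring
  have h2 : ∫ g : Matrix.specialUnitaryGroup (Fin n) 𝕜,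
      (∑ i, ∑ j, β i * α j * entrySq (g : Matrix _ _ 𝕜) i j) ^ 2 ∂haarProb _ =
      ∑ i, ∑ j, ∑ k, ∑ l, β i * α j * (β k * α l) * entryMoment 𝕜 i j k l := by
    simp only [h1]
    rw [integral_finsetSum _ fun i _ => integrable_finsetSum _ fun j _ =>
      integrable_finsetSum _ fun k _ => integrable_finsetSum _ fun l _ => hi i j k l]
    refine Finset.sum_congr rfl fun i _ => ?_
    rw [integral_finsetSum _ fun j _ =>
      integrable_finsetSum _ fun k _ => integrable_finsetSum _ fun l _ => hi i j k l]
    refine Finset.sum_congr rfl fun j _ => ?_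
    rw [integral_finsetSum _ fun k _ => integrable_finsetSum _ fun l _ => hi i j k l]
    refine Finset.sum_congr rfl fun k _ => ?_
    rw [integral_finsetSum _ fun l _ => hi i j k l]
    refine Finset.sum_congr rfl fun l _ => ?_
    rw [integral_const_mul, entryMoment]
  rw [h2]
  -- Summing over `l` kills the `c` and `br` terms because `∑ α = 0`; the sum over `k` in `h4` then
  -- kills the `bc` term because `∑ β = 0`.
  have h3 : ∀ i j k, ∑ l, β i * α j * (β k * α l) * entryMoment 𝕜 i j k l =
      β i * α j * (β k * (α j * bc + if i = k then α j * e else 0)) := by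
    intro i j k
    have : ∀ l, β i * α j * (β k * α l) * entryMoment 𝕜 i j k l =
        β i * α j * β k * ((c + if i = k then br else 0) * α l +
          if j = l then α l * bc + (if i = k then α l * e else 0) else 0) := by
      intro l
      rw [key]
      split_ifs <;> ring
    simp only [this]
    rw [← Finset.mul_sum, Finset.sum_add_distrib, ← Finset.mul_sum, hα, Finset.sum_ite_eq]
    simp
    ring
  have h4 : ∀ i j, ∑ k, β i * α j * (β k * (α j * bc + if i = k then α j * e else 0)) =
      e * (β i ^ 2 * α j ^ 2) := by
    intro i j
    have : ∀ k, β i * α j * (β k * (α j * bc + if i = k then α j * e else 0)) =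
        β i * α j * (α j * bc * β k + if i = k then β k * (α j * e) else 0) := by
      intro k
      split_ifs <;> ring
    simp only [this]
    rw [← Finset.mul_sum, Finset.sum_add_distrib, ← Finset.mul_sum, hβ, Finset.sum_ite_eq]
    simp
    ring
  simp only [h3, h4, ← Finset.mul_sum]
  rw [mul_assoc, Finset.sum_mul_sum]
  simp only [Finset.mul_sum]

end SecondMoment

/-! ### Frobenius norms and matrix coefficients of conjugation. -/

section Frobenius

variable {n : ℕ} {𝕜 : Type*} [RCLike 𝕜]

theorem re_two_mul (z : 𝕜) : RCLike.re (2 * z) = 2 * RCLike.re z := by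
  rw [two_mul, map_add, two_mul]

theorem conjTranspose_mem_unitaryGroup {u : Matrix (Fin n) (Fin n) 𝕜}
    (hu : u ∈ Matrix.unitaryGroup (Fin n) 𝕜) :
    u.conjTranspose ∈ Matrix.unitaryGroup (Fin n) 𝕜 :=
  Unitary.star_mem hu

/-- The squared Frobenius norm. -/
def frobSq (A : Matrix (Fin n) (Fin n) 𝕜) : ℝ := ∑ i, ∑ j, ‖A i j‖ ^ 2

theorem frobSq_nonneg (A : Matrix (Fin n) (Fin n) 𝕜) : 0 ≤ frobSq A :=
  Finset.sum_nonneg fun _ _ => Finset.sum_nonneg fun _ _ => sq_nonneg _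

theorem frobSq_eq_trace (A : Matrix (Fin n) (Fin n) 𝕜) :
    frobSq A = RCLike.re (A * A.conjTranspose).trace := by
  simp only [frobSq, Matrix.trace, Matrix.diag, Matrix.mul_apply, map_sum]
  refine Finset.sum_congr rfl fun i _ => Finset.sum_congr rfl fun j _ => ?_
  rw [Matrix.conjTranspose_apply, RCLike.star_def, RCLike.mul_conj, ← RCLike.ofReal_pow,
    RCLike.ofReal_re]

theorem sq_re_trace_mul_le (A B : Matrix (Fin n) (Fin n) 𝕜) :
    RCLike.re (A * B).trace ^ 2 ≤ frobSq A * frobSq B := by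
  have h1 : |RCLike.re (A * B).trace| ≤ ∑ p : Fin n × Fin n, ‖A p.1 p.2‖ * ‖B p.2 p.1‖ := by
    rw [Fintype.sum_prod_type]
    refine (RCLike.abs_re_le_norm _).trans ?_
    simp only [Matrix.trace, Matrix.diag, Matrix.mul_apply]
    refine (norm_sum_le _ _).trans (Finset.sum_le_sum fun i _ => (norm_sum_le _ _).trans ?_)
    exact Finset.sum_le_sum fun j _ => norm_mul_le _ _
  have h2 := Finset.sum_mul_sq_le_sq_mul_sq Finset.univ
    (fun p : Fin n × Fin n => ‖A p.1 p.2‖) (fun p => ‖B p.2 p.1‖)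
  rw [Fintype.sum_prod_type (fun p : Fin n × Fin n => ‖A p.1 p.2‖ ^ 2),
    Fintype.sum_prod_type_right (fun p : Fin n × Fin n => ‖B p.2 p.1‖ ^ 2)] at h2
  rw [← sq_abs]
  exact (pow_le_pow_left₀ (abs_nonneg _) h1 2).trans h2

theorem exists_eq_unitary_mul_diagonal {A : Matrix (Fin n) (Fin n) 𝕜} (hA : A.IsHermitian) :
    ∃ u ∈ Matrix.unitaryGroup (Fin n) 𝕜, ∃ α : Fin n → ℝ,
      A = u * Matrix.diagonal (fun i => (α i : 𝕜)) * u.conjTranspose ∧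
      RCLike.re A.trace = ∑ i, α i ∧ frobSq A = ∑ i, α i ^ 2 := by
  have hu := hA.eigenvectorUnitary.2
  have hspec : A = (hA.eigenvectorUnitary : Matrix (Fin n) (Fin n) 𝕜) *
      Matrix.diagonal (fun i => (hA.eigenvalues i : 𝕜)) *
      (hA.eigenvectorUnitary : Matrix (Fin n) (Fin n) 𝕜).conjTranspose := hA.spectral_theorem
  revert hu hspec
  generalize (hA.eigenvectorUnitary : Matrix (Fin n) (Fin n) 𝕜) = u
  generalize hA.eigenvalues = α
  intro hu hspec
  have huu : u.conjTranspose * u = 1 := Matrix.mem_unitaryGroup_iff'.1 hu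
  refine ⟨u, hu, α, hspec, ?_, ?_⟩
  · rw [hspec, Matrix.trace_mul_comm, ← mul_assoc, huu, one_mul, Matrix.trace_diagonal, map_sum]
    simp
  · have hsq : A * A.conjTranspose =
        u * Matrix.diagonal (fun i => (α i : 𝕜) * (α i : 𝕜)) * u.conjTranspose := by
      rw [hA.eq]
      conv_lhs => rw [hspec]
      rw [← Matrix.diagonal_mul_diagonal]
      calc _ = u * Matrix.diagonal (fun i => (α i : 𝕜)) * (u.conjTranspose * u) *
          Matrix.diagonal (fun i => (α i : 𝕜)) * u.conjTranspose := by simp only [mul_assoc]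
        _ = _ := by rw [huu, mul_one]; simp only [mul_assoc]
    rw [frobSq_eq_trace, hsq, Matrix.trace_mul_comm, ← mul_assoc, huu, one_mul,
      Matrix.trace_diagonal, map_sum]
    refine Finset.sum_congr rfl fun i _ => ?_
    rw [← RCLike.ofReal_mul, RCLike.ofReal_re, sq]

theorem integral_entrySq_mul_mul [NeZero n] {u v : Matrix (Fin n) (Fin n) 𝕜}
    (hv : v ∈ Matrix.unitaryGroup (Fin n) 𝕜) (hu : u ∈ Matrix.unitaryGroup (Fin n) 𝕜)
    (F : (Fin n → Fin n → ℝ) → ℝ) :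
    ∫ g : Matrix.specialUnitaryGroup (Fin n) 𝕜, F (entrySq (v * (g : Matrix _ _ 𝕜) * u))
        ∂haarProb _ =
      ∫ g : Matrix.specialUnitaryGroup (Fin n) 𝕜, F (entrySq (g : Matrix _ _ 𝕜)) ∂haarProb _ := by
  obtain ⟨d, hd, hmem, -⟩ := exists_diagonal_mem_specialUnitaryGroup hu
  rw [← integral_entrySq_mul_left hv F]
  refine Eq.trans ?_ (integral_mul_right_eq_self (fun g : Matrix.specialUnitaryGroup (Fin n) 𝕜 =>
    F (entrySq (v * (g : Matrix _ _ 𝕜)))) ⟨_, hmem⟩)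
  refine integral_congr_ae (Filter.Eventually.of_forall fun g => ?_)
  refine congrArg F (funext fun i => funext fun j => ?_)
  rw [entrySq, entrySq, Submonoid.coe_mul, ← mul_assoc, ← mul_assoc, Matrix.mul_diagonal, norm_mul,
    hd, mul_one]

/-- The matrix coefficient `g ↦ Re Tr (g A g† B)` of the adjoint representation. -/
noncomputable def adjointCoeff (A B g : Matrix (Fin n) (Fin n) 𝕜) : ℝ :=
  RCLike.re (g * A * g.conjTranspose * B).trace

/-- By cyclicity of the trace both eigenbases move into `W = v† g u`, leaving `Tr(W diag(α) W†
diag(β))`, which sees only the moduli of `W`. -/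
theorem adjointCoeff_diagonal (α β : Fin n → ℝ) (u v g : Matrix (Fin n) (Fin n) 𝕜) :
    adjointCoeff (u * Matrix.diagonal (fun i => (α i : 𝕜)) * u.conjTranspose)
      (v * Matrix.diagonal (fun i => (β i : 𝕜)) * v.conjTranspose) g =
      ∑ i, ∑ j, β i * α j * entrySq (v.conjTranspose * g * u) i j := by
  have h1 : (g * (u * Matrix.diagonal (fun i => (α i : 𝕜)) * u.conjTranspose) * g.conjTranspose *
      (v * Matrix.diagonal (fun i => (β i : 𝕜)) * v.conjTranspose)).trace =
      ((v.conjTranspose * g * u) * Matrix.diagonal (fun i => (α i : 𝕜)) *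
        (v.conjTranspose * g * u).conjTranspose * Matrix.diagonal (fun i => (β i : 𝕜))).trace := by
    rw [← mul_assoc, Matrix.trace_mul_comm]
    simp only [Matrix.conjTranspose_mul, Matrix.conjTranspose_conjTranspose, mul_assoc]
  rw [adjointCoeff, h1]
  generalize v.conjTranspose * g * u = W
  simp only [Matrix.trace, Matrix.diag, Matrix.mul_diagonal]
  rw [map_sum]
  refine Finset.sum_congr rfl fun i _ => ?_
  rw [Matrix.mul_apply, Finset.sum_mul, map_sum]
  refine Finset.sum_congr rfl fun j _ => ?_
  rw [Matrix.mul_diagonal, Matrix.conjTranspose_apply, RCLike.star_def]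
  have : W i j * (α j : 𝕜) * (starRingEnd 𝕜) (W i j) * (β i : 𝕜) =
      ((β i * α j * ‖W i j‖ ^ 2 : ℝ) : 𝕜) := by
    push_cast
    rw [← RCLike.mul_conj]
    ring
  rw [this, RCLike.ofReal_re, entrySq]

theorem integral_adjointCoeff (hn : 2 ≤ n) {A B : Matrix (Fin n) (Fin n) 𝕜} (hA : A.IsHermitian)
    (hB : B.IsHermitian) (hAt : A.trace = 0) :
    ∫ g : Matrix.specialUnitaryGroup (Fin n) 𝕜, adjointCoeff A B (g : Matrix _ _ 𝕜) ∂haarProb _ =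
      0 := by
  have : NeZero n := ⟨by omega⟩
  obtain ⟨u, hu, α, rfl, ht, -⟩ := exists_eq_unitary_mul_diagonal hA
  obtain ⟨v, hv, β, rfl, -, -⟩ := exists_eq_unitary_mul_diagonal hB
  simp only [adjointCoeff_diagonal]
  rw [integral_entrySq_mul_mul (conjTranspose_mem_unitaryGroup hv) hu
    fun p => ∑ i, ∑ j, β i * α j * p i j, integral_bilinear_entrySq, ← ht, hAt]
  simp

theorem exists_integral_adjointCoeff_sq (𝕜 : Type*) [RCLike 𝕜] (hn : 2 ≤ n) :
    ∃ e : ℝ, 1 / (n * (n + 1)) ≤ e ∧ ∀ A B : Matrix (Fin n) (Fin n) 𝕜, A.IsHermitian →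
      B.IsHermitian → A.trace = 0 → B.trace = 0 →
      ∫ g : Matrix.specialUnitaryGroup (Fin n) 𝕜, adjointCoeff A B (g : Matrix _ _ 𝕜) ^ 2
        ∂haarProb _ = e * frobSq A * frobSq B := by
  have : NeZero n := ⟨by omega⟩
  obtain ⟨e, he, key⟩ := exists_integral_bilinear_entrySq_sq 𝕜 hn
  refine ⟨e, he, fun A B hA hB hAt hBt => ?_⟩
  obtain ⟨u, hu, α, hAe, hα, hα2⟩ := exists_eq_unitary_mul_diagonal hA
  obtain ⟨v, hv, β, hBe, hβ, hβ2⟩ := exists_eq_unitary_mul_diagonal hB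
  rw [hα2, hβ2, hAe, hBe]
  simp only [adjointCoeff_diagonal]
  rw [integral_entrySq_mul_mul (conjTranspose_mem_unitaryGroup hv) hu
    fun p => (∑ i, ∑ j, β i * α j * p i j) ^ 2, key α β (by rw [← hα, hAt, map_zero])
      (by rw [← hβ, hBt, map_zero])]
  ring

/-- The symmetric matrix units `E_jk + E_kj`. -/
def symUnit (𝕜 : Type*) [RCLike 𝕜] (j k : Fin n) : Matrix (Fin n) (Fin n) 𝕜 :=
  Matrix.single j k 1 + Matrix.single k j 1

theorem isHermitian_symUnit (j k : Fin n) : (symUnit 𝕜 j k).IsHermitian := by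
  rw [Matrix.IsHermitian, symUnit, Matrix.conjTranspose_add, Matrix.conjTranspose_single,
    Matrix.conjTranspose_single, star_one, add_comm]

theorem trace_mul_symUnit (M : Matrix (Fin n) (Fin n) 𝕜) (j k : Fin n) :
    (M * symUnit 𝕜 j k).trace = M k j + M j k := by
  rw [symUnit, mul_add, Matrix.trace_add, Matrix.trace_mul_single, Matrix.trace_mul_single]
  simp

theorem isHermitian_lie {A h : Matrix (Fin n) (Fin n) 𝕜} (hA : A.IsHermitian)
    (hh : h.conjTranspose = -h) : (h * A - A * h).IsHermitian := by
  rw [Matrix.IsHermitian, Matrix.conjTranspose_sub, Matrix.conjTranspose_mul,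
    Matrix.conjTranspose_mul, hA.eq, hh]
  simp only [mul_neg, neg_mul]
  abel

theorem trace_lie (A h : Matrix (Fin n) (Fin n) 𝕜) : (h * A - A * h).trace = 0 := by
  rw [Matrix.trace_sub, Matrix.trace_mul_comm, sub_self]

theorem trace_single_mul_mul_single_mul (X Y : Matrix (Fin n) (Fin n) 𝕜) (a b c d : Fin n) :
    (Matrix.single a b 1 * X * Matrix.single c d 1 * Y).trace = X b c * Y d a := by
  rw [mul_assoc, mul_assoc, Matrix.trace_single_mul]
  simp [Matrix.mul_apply, Matrix.single_apply, ite_and]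

theorem frobSq_lie_symUnit {h : Matrix (Fin n) (Fin n) 𝕜} (hh : h.conjTranspose = -h)
    (j k : Fin n) :
    frobSq (h * symUnit 𝕜 j k - symUnit 𝕜 j k * h) =
      2 * RCLike.re (h j k * h j k + h k j * h k j + 2 * (h j j * h k k)) -
      2 * RCLike.re ((h * h) j j + (h * h) k k +
        if j = k then (h * h) j k + (h * h) k j else 0) := by
  set S := symUnit 𝕜 j k with hS
  have h1 : ((h * S - S * h) * (h * S - S * h)).trace =
      2 * (S * h * S * h).trace - 2 * (S * 1 * S * (h * h)).trace := by
    have e1 : (h * S * (h * S)).trace = (S * h * S * h).trace := by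
      rw [← mul_assoc, Matrix.trace_mul_comm]; simp only [mul_assoc]
    have e2 : (h * S * (S * h)).trace = (S * 1 * S * (h * h)).trace := by
      rw [mul_assoc, Matrix.trace_mul_comm]; simp only [mul_assoc, mul_one]
    have e3 : (S * h * (h * S)).trace = (S * 1 * S * (h * h)).trace := by
      rw [← mul_assoc, Matrix.trace_mul_comm]; simp only [mul_assoc, mul_one]
    have e4 : (S * h * (S * h)).trace = (S * h * S * h).trace := by simp only [mul_assoc]
    rw [sub_mul, mul_sub, mul_sub, Matrix.trace_sub, Matrix.trace_sub, Matrix.trace_sub, e1, e2, e3,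
      e4]
    ring
  have h2 : ∀ X Y : Matrix (Fin n) (Fin n) 𝕜, (S * X * S * Y).trace =
      X k j * Y k j + X k k * Y j j + X j j * Y k k + X j k * Y j k := by
    intro X Y
    simp only [hS, symUnit, add_mul, mul_add, Matrix.trace_add, trace_single_mul_mul_single_mul]
    ring
  rw [frobSq_eq_trace, (isHermitian_lie (isHermitian_symUnit j k) hh).eq, h1, h2, h2]
  by_cases hjk : j = k
  · subst hjk
    simp only [Matrix.one_apply_eq, if_true, one_mul, map_sub, map_add, re_two_mul]
    ring
  · simp only [Matrix.one_apply_eq, Matrix.one_apply_ne hjk, Matrix.one_apply_ne (Ne.symm hjk),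
      hjk, if_false, one_mul, zero_mul, map_sub, map_add, re_two_mul, map_zero,
      mul_comm (h k k) (h j j)]
    ring

/-- Summing the formula for one commutator, the products of diagonal entries vanish since `Tr h =
0`, and the `(h²)_jj` terms give `4n‖h‖²`. The terms `Re(h_jk²)` cost at most `4‖h‖²`, exactly what
the doubled diagonal contribution `j = k` returns. -/
theorem sum_frobSq_lie_symUnit {h : Matrix (Fin n) (Fin n) 𝕜} (hh : h.conjTranspose = -h)
    (ht : h.trace = 0) :
    4 * n * frobSq h ≤ ∑ j, ∑ k, frobSq (h * symUnit 𝕜 j k - symUnit 𝕜 j k * h) := by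
  have hf : frobSq h = - ∑ j, RCLike.re ((h * h) j j) := by
    rw [frobSq_eq_trace, hh, mul_neg, Matrix.trace_neg, map_neg, Matrix.trace, map_sum]
    rfl
  have hd : ∑ j, ∑ k, RCLike.re (h j j * h k k) = 0 := by
    simp only [← map_sum, ← Finset.mul_sum, ← Finset.sum_mul]
    have : ∑ k, h k k = 0 := ht
    rw [this]
    simp
  have hsq : ∀ z : 𝕜, -‖z‖ ^ 2 ≤ RCLike.re (z * z) := by
    intro z
    rw [RCLike.norm_sq_eq_def, RCLike.mul_re]
    nlinarith [mul_self_nonneg (RCLike.re z)]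
  have h1 : -frobSq h ≤ ∑ j, ∑ k, RCLike.re (h j k * h j k) := by
    unfold frobSq
    rw [← Finset.sum_neg_distrib]
    refine Finset.sum_le_sum fun j _ => ?_
    rw [← Finset.sum_neg_distrib]
    exact Finset.sum_le_sum fun k _ => hsq _
  have h2 : ∑ j, ∑ k, RCLike.re (h k j * h k j) = ∑ j, ∑ k, RCLike.re (h j k * h j k) :=
    Finset.sum_comm
  simp only [frobSq_lie_symUnit hh, map_add, re_two_mul, Finset.sum_sub_distrib,
    ← Finset.mul_sum, Finset.sum_add_distrib, apply_ite RCLike.re, map_zero, Finset.sum_ite_eq,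
    Finset.mem_univ, if_true, hd, h2, Finset.sum_const, Finset.card_univ, Fintype.card_fin,
    nsmul_eq_mul]
  nlinarith

end Frobenius

/-! ### The variance for two independent group elements. -/

section CoreVariance

variable {n : ℕ} {𝕜 : Type*} [RCLike 𝕜]

theorem continuous_frobSq : Continuous (frobSq : Matrix (Fin n) (Fin n) 𝕜 → ℝ) := by
  unfold frobSq
  exact continuous_finsetSum _ fun i _ => continuous_finsetSum _ fun j _ =>
    ((continuous_id.matrix_elem i j).norm).pow 2

theorem continuous_adjointCoeff {X : Type*} [TopologicalSpace X]
    {A g : X → Matrix (Fin n) (Fin n) 𝕜} (hA : Continuous A) (hg : Continuous g)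
    (B : Matrix (Fin n) (Fin n) 𝕜) : Continuous fun x => adjointCoeff (A x) B (g x) :=
  RCLike.continuous_re.comp
    (((hg.matrix_mul hA).matrix_mul hg.matrix_conjTranspose).matrix_mul
      continuous_const).matrix_trace

theorem isHermitian_conj {D : Matrix (Fin n) (Fin n) 𝕜} (hD : D.IsHermitian)
    (g : Matrix (Fin n) (Fin n) 𝕜) : (g * D * g.conjTranspose).IsHermitian :=
  Matrix.isHermitian_mul_mul_conjTranspose g hD

/-- The commutator of `h` with a conjugate of `D`. -/
def lieConj (h D g : Matrix (Fin n) (Fin n) 𝕜) : Matrix (Fin n) (Fin n) 𝕜 :=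
  h * (g * D * g.conjTranspose) - g * D * g.conjTranspose * h

theorem continuous_coe_specialUnitaryGroup :
    Continuous fun g : Matrix.specialUnitaryGroup (Fin n) 𝕜 => (g : Matrix (Fin n) (Fin n) 𝕜) :=
  continuous_subtype_val

theorem continuous_lieConj (h D : Matrix (Fin n) (Fin n) 𝕜) :
    Continuous fun g : Matrix.specialUnitaryGroup (Fin n) 𝕜 =>
      lieConj h D (g : Matrix (Fin n) (Fin n) 𝕜) := by
  have hg := continuous_coe_specialUnitaryGroup (n := n) (𝕜 := 𝕜)
  have hA := (hg.matrix_mul (continuous_const (y := D))).matrix_mul hg.matrix_conjTranspose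
  exact (continuous_const.matrix_mul hA).sub (hA.matrix_mul continuous_const)

theorem integrable_adjointCoeff_sq (A B : Matrix (Fin n) (Fin n) 𝕜) :
    Integrable (fun g : Matrix.specialUnitaryGroup (Fin n) 𝕜 =>
      adjointCoeff A B (g : Matrix (Fin n) (Fin n) 𝕜) ^ 2) (haarProb _) :=
  ((continuous_adjointCoeff continuous_const continuous_coe_specialUnitaryGroup B).pow
    2).integrable_haarProb

/-- Moving the commutator across the trace, each coefficient is `-2 Re M_jk` for the Hermitian `M =
[h, g D g†]`. Dropping the imaginary parts keeps the argument valid over both fields. -/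
theorem sum_adjointCoeff_sq_le_frobSq {D h : Matrix (Fin n) (Fin n) 𝕜} (hD : D.IsHermitian)
    (hh : h.conjTranspose = -h) (g : Matrix (Fin n) (Fin n) 𝕜) :
    ∑ j, ∑ k, adjointCoeff D (h * symUnit 𝕜 j k - symUnit 𝕜 j k * h) g ^ 2 / 4 ≤
      frobSq (lieConj h D g) := by
  have hA := isHermitian_conj hD g
  have hM := isHermitian_lie hA hh
  unfold frobSq adjointCoeff lieConj
  generalize g * D * g.conjTranspose = A at *
  refine Finset.sum_le_sum fun j _ => Finset.sum_le_sum fun k _ => ?_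
  have h1 : (A * (h * symUnit 𝕜 j k - symUnit 𝕜 j k * h)).trace =
      -((h * A - A * h) * symUnit 𝕜 j k).trace := by
    rw [mul_sub, sub_mul, Matrix.trace_sub, Matrix.trace_sub, ← mul_assoc, ← mul_assoc,
      Matrix.trace_mul_comm (A * symUnit 𝕜 j k) h, ← mul_assoc]
    ring
  rw [h1, trace_mul_symUnit, ← hM.apply k j, RCLike.star_def, map_neg, map_add, RCLike.conj_re]
  rw [RCLike.norm_sq_eq_def]
  nlinarith [mul_self_nonneg (RCLike.im ((h * A - A * h) j k))]

/-- The test matrices turn `‖[h, g D g†]‖²` into a sum of squared coefficients of `D` against `[h,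
E_jk + E_kj]`, so the second-moment formula applies term by term. -/
theorem le_integral_frobSq_lie {e : ℝ} (he : 0 ≤ e)
    (key : ∀ A B : Matrix (Fin n) (Fin n) 𝕜, A.IsHermitian →
      B.IsHermitian → A.trace = 0 → B.trace = 0 →
      ∫ g : Matrix.specialUnitaryGroup (Fin n) 𝕜, adjointCoeff A B (g : Matrix _ _ 𝕜) ^ 2
        ∂haarProb _ = e * frobSq A * frobSq B)
    {D h : Matrix (Fin n) (Fin n) 𝕜} (hD : D.IsHermitian) (hDt : D.trace = 0)
    (hh : h.conjTranspose = -h) (ht : h.trace = 0) :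
    e * n * frobSq D * frobSq h ≤ ∫ g : Matrix.specialUnitaryGroup (Fin n) 𝕜,
      frobSq (lieConj h D (g : Matrix _ _ 𝕜)) ∂haarProb _ := by
  have i1 : Integrable (fun g : Matrix.specialUnitaryGroup (Fin n) 𝕜 =>
      frobSq (lieConj h D (g : Matrix _ _ 𝕜))) (haarProb _) :=
    (continuous_frobSq.comp (continuous_lieConj h D)).integrable_haarProb
  have i2 : ∀ j k, Integrable (fun g : Matrix.specialUnitaryGroup (Fin n) 𝕜 =>
      adjointCoeff D (h * symUnit 𝕜 j k - symUnit 𝕜 j k * h) (g : Matrix _ _ 𝕜) ^ 2 / 4)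
      (haarProb _) := fun j k => (integrable_adjointCoeff_sq _ _).div_const 4
  have hle : ∀ g : Matrix.specialUnitaryGroup (Fin n) 𝕜, ∑ j, ∑ k,
      adjointCoeff D (h * symUnit 𝕜 j k - symUnit 𝕜 j k * h) (g : Matrix _ _ 𝕜) ^ 2 / 4 ≤
      frobSq (lieConj h D (g : Matrix _ _ 𝕜)) := fun g => sum_adjointCoeff_sq_le_frobSq hD hh _
  have hmono := integral_mono_of_nonneg (Filter.Eventually.of_forall fun g =>
    Finset.sum_nonneg fun j _ => Finset.sum_nonneg fun k _ => by positivity) i1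
    (Filter.Eventually.of_forall hle)
  refine le_trans ?_ hmono
  have h2 : ∀ j k, ∫ g : Matrix.specialUnitaryGroup (Fin n) 𝕜,
      adjointCoeff D (h * symUnit 𝕜 j k - symUnit 𝕜 j k * h) (g : Matrix _ _ 𝕜) ^ 2 / 4
      ∂haarProb _ = e * frobSq D * frobSq (h * symUnit 𝕜 j k - symUnit 𝕜 j k * h) / 4 :=
    fun j k => by
      rw [integral_div, key _ _ hD (isHermitian_lie (isHermitian_symUnit j k) hh) hDt
        (trace_lie _ _)]
  have h3 : ∫ g : Matrix.specialUnitaryGroup (Fin n) 𝕜, ∑ j, ∑ k,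
      adjointCoeff D (h * symUnit 𝕜 j k - symUnit 𝕜 j k * h) (g : Matrix _ _ 𝕜) ^ 2 / 4
      ∂haarProb _ = ∑ j, ∑ k,
        e * frobSq D * frobSq (h * symUnit 𝕜 j k - symUnit 𝕜 j k * h) / 4 := by
    rw [integral_finsetSum _ fun j _ => integrable_finsetSum _ fun k _ => i2 j k]
    refine Finset.sum_congr rfl fun j _ => ?_
    rw [integral_finsetSum _ fun k _ => i2 j k]
    exact Finset.sum_congr rfl fun k _ => h2 j k
  rw [h3]
  simp only [← Finset.sum_div, ← Finset.mul_sum]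
  have h4 := mul_le_mul_of_nonneg_left (sum_frobSq_lie_symUnit hh ht)
    (mul_nonneg he (frobSq_nonneg D))
  rw [le_div_iff₀ (by norm_num)]
  calc e * n * frobSq D * frobSq h * 4 = e * frobSq D * (4 * n * frobSq h) := by ring
    _ ≤ _ := h4

/-- The variance of the second-order matrix coefficient, for independent group elements. -/
theorem le_variance_adjointCoeff (hn : 2 ≤ n) {D B h : Matrix (Fin n) (Fin n) 𝕜}
    (hD : D.IsHermitian) (hDt : D.trace = 0) (hB : B.IsHermitian) (hBt : B.trace = 0)
    (hh : h.conjTranspose = -h) (ht : h.trace = 0) :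
    4 * (1 / (n * (n + 1))) ^ 2 * n * frobSq D * frobSq h * frobSq B ≤
      ProbabilityTheory.variance (fun g : Matrix.specialUnitaryGroup (Fin n) 𝕜 ×
          Matrix.specialUnitaryGroup (Fin n) 𝕜 =>
        -2 * adjointCoeff (lieConj h D (g.1 : Matrix _ _ 𝕜)) B (g.2 : Matrix _ _ 𝕜)) ((haarProb _).prod (haarProb _)) := by
  obtain ⟨e, he, key⟩ := exists_integral_adjointCoeff_sq 𝕜 hn
  have he0 : 0 ≤ 1 / ((n : ℝ) * (n + 1)) := by positivity
  set M : Matrix.specialUnitaryGroup (Fin n) 𝕜 → Matrix (Fin n) (Fin n) 𝕜 := fun g =>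
    lieConj h D (g : Matrix _ _ 𝕜) with hM
  have hMH : ∀ g, (M g).IsHermitian := fun g => isHermitian_lie (isHermitian_conj hD _) hh
  have hMt : ∀ g, (M g).trace = 0 := fun g => trace_lie _ _
  set X : Matrix.specialUnitaryGroup (Fin n) 𝕜 × Matrix.specialUnitaryGroup (Fin n) 𝕜 → ℝ :=
    fun g => -2 * adjointCoeff (M g.1) B (g.2 : Matrix _ _ 𝕜) with hX
  have hXc : Continuous X :=
    continuous_const.mul (continuous_adjointCoeff ((continuous_lieConj h D).comp continuous_fst)
      (continuous_coe_specialUnitaryGroup.comp continuous_snd) B)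
  have hint : ∀ {f : Matrix.specialUnitaryGroup (Fin n) 𝕜 ×
      Matrix.specialUnitaryGroup (Fin n) 𝕜 → ℝ}, Continuous f →
      Integrable f ((haarProb _).prod (haarProb _)) := fun hf =>
    hf.integrable_of_hasCompactSupport (HasCompactSupport.of_compactSpace _)
  have h0 : ∫ g, X g ∂((haarProb _).prod (haarProb _)) = 0 := by
    rw [integral_prod _ (hint hXc)]
    simp only [hX, integral_const_mul, integral_adjointCoeff hn (hMH _) hB (hMt _), mul_zero,
      integral_zero]
  rw [ProbabilityTheory.variance_of_integral_eq_zero hXc.measurable.aemeasurable h0,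
    integral_prod (fun g => X g ^ 2) (hint (hXc.pow 2))]
  have h1 : ∀ g₁ : Matrix.specialUnitaryGroup (Fin n) 𝕜,
      ∫ g₂ : Matrix.specialUnitaryGroup (Fin n) 𝕜, X (g₁, g₂) ^ 2 ∂haarProb _ =
        4 * e * frobSq B * frobSq (M g₁) := by
    intro g₁
    have : ∀ g₂, X (g₁, g₂) ^ 2 = 4 * adjointCoeff (M g₁) B (g₂ : Matrix _ _ 𝕜) ^ 2 := by
      intro g₂
      simp only [hX]
      ring
    simp only [this, integral_const_mul, key _ _ (hMH g₁) hB (hMt g₁) hBt]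
    ring
  simp only [h1, integral_const_mul]
  have h2 := le_integral_frobSq_lie (he0.trans he) key hD hDt hh ht
  have hP : 0 ≤ n * frobSq D * frobSq h * frobSq B := by
    have := frobSq_nonneg D; have := frobSq_nonneg h; have := frobSq_nonneg B
    positivity
  calc 4 * (1 / ((n : ℝ) * (n + 1))) ^ 2 * n * frobSq D * frobSq h * frobSq B
      = 4 * (1 / ((n : ℝ) * (n + 1))) ^ 2 * (n * frobSq D * frobSq h * frobSq B) := by ring
    _ ≤ 4 * e ^ 2 * (n * frobSq D * frobSq h * frobSq B) := by gcongr
    _ = 4 * e * frobSq B * (e * n * frobSq D * frobSq h) := by ring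
    _ ≤ _ := by
      refine mul_le_mul_of_nonneg_left h2 ?_
      have := frobSq_nonneg B
      have := he0.trans he
      positivity

/-- Every real linear functional on matrices is, on traceless Hermitian matrices, the pairing with
a traceless Hermitian matrix. -/
theorem exists_traceless_isHermitian_repr [NeZero n] (L : Matrix (Fin n) (Fin n) 𝕜 →ₗ[ℝ] ℝ) :
    ∃ B : Matrix (Fin n) (Fin n) 𝕜, B.IsHermitian ∧ B.trace = 0 ∧
      ∀ A : Matrix (Fin n) (Fin n) 𝕜, A.IsHermitian → A.trace = 0 →
        L A = RCLike.re (A * B).trace := by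
  -- Real linearity gives `L(z E_ij) = Re(z (L(E_ij) - i L(i E_ij)))`, which dictates the entries of
  -- `R`; over `ℝ` the term with `I` is zero. Hermitian inputs see only the Hermitian part of `R`,
  -- traceless ones only its traceless part.
  let R : Matrix (Fin n) (Fin n) 𝕜 := Matrix.of fun j i =>
    (L (Matrix.single i j 1) : 𝕜) - (L (Matrix.single i j RCLike.I) : 𝕜) * RCLike.I
  have hR : ∀ A, L A = RCLike.re (A * R).trace := by
    intro A
    conv_lhs => rw [Matrix.matrix_eq_sum_single A]
    simp only [map_sum, Matrix.trace, Matrix.diag, Matrix.mul_apply]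
    refine Finset.sum_congr rfl fun i _ => Finset.sum_congr rfl fun j _ => ?_
    have : Matrix.single i j (A i j) = RCLike.re (A i j) • Matrix.single i j (1 : 𝕜) +
        RCLike.im (A i j) • Matrix.single i j (RCLike.I : 𝕜) := by
      rw [Matrix.smul_single, Matrix.smul_single, ← Matrix.single_add]
      congr 1
      rw [RCLike.real_smul_eq_coe_mul, RCLike.real_smul_eq_coe_mul, mul_one, RCLike.re_add_im]
    rw [this, map_add, map_smul, map_smul, smul_eq_mul, smul_eq_mul]
    simp only [R, Matrix.of_apply, RCLike.mul_re, map_sub, RCLike.ofReal_re, RCLike.mul_im,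
      RCLike.ofReal_im, RCLike.I_re]
    rcases RCLike.I_eq_zero_or_im_I_eq_one (K := 𝕜) with h | h
    · simp [h]
    · rw [h]; ring
  obtain ⟨B₀, hB₀, hL⟩ : ∃ B₀ : Matrix (Fin n) (Fin n) 𝕜, B₀.IsHermitian ∧
      ∀ A : Matrix (Fin n) (Fin n) 𝕜, A.IsHermitian → L A = RCLike.re (A * B₀).trace := by
    refine ⟨((1 / 2 : ℝ) : 𝕜) • (R + R.conjTranspose), ?_, fun A hA => ?_⟩
    · rw [Matrix.IsHermitian, Matrix.conjTranspose_smul, Matrix.conjTranspose_add,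
        Matrix.conjTranspose_conjTranspose, RCLike.star_def, RCLike.conj_ofReal, add_comm]
    · have h1 : RCLike.re (A * R.conjTranspose).trace = RCLike.re (A * R).trace := by
        rw [← RCLike.conj_re (A * R).trace, ← RCLike.star_def, ← Matrix.trace_conjTranspose,
          Matrix.conjTranspose_mul, hA.eq, Matrix.trace_mul_comm]
      rw [hR A, Matrix.mul_smul, Matrix.trace_smul, smul_eq_mul, RCLike.re_ofReal_mul,
        mul_add, Matrix.trace_add, map_add, h1]
      ring
  have hr : (RCLike.re B₀.trace : 𝕜) = B₀.trace := by
    rw [← RCLike.conj_eq_iff_re, ← RCLike.star_def, ← Matrix.trace_conjTranspose, hB₀.eq]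
  refine ⟨B₀ - ((RCLike.re B₀.trace / n : ℝ) : 𝕜) • 1, ?_, ?_, fun A hA hAt => ?_⟩
  · refine hB₀.sub ?_
    rw [Matrix.IsHermitian, Matrix.conjTranspose_smul, Matrix.conjTranspose_one, RCLike.star_def,
      RCLike.conj_ofReal]
  · rw [Matrix.trace_sub, Matrix.trace_smul, Matrix.trace_one, Fintype.card_fin, smul_eq_mul,
      RCLike.ofReal_div, hr, RCLike.ofReal_natCast, div_mul_cancel₀, sub_self]
    exact Nat.cast_ne_zero.2 (NeZero.ne n)
  · rw [hL A hA, mul_sub, Matrix.mul_smul, mul_one, Matrix.trace_sub, Matrix.trace_smul, hAt,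
      smul_zero, sub_zero]

end CoreVariance

/-! ### Reduction of the gradient to `n × n` matrices. -/

theorem compoundDifferential_smul {n : ℕ} (a : ℂ) (A : Matrix (Fin n) (Fin n) ℂ) :
    compoundDifferential (a • A) = a • compoundDifferential A :=
  map_smul (compoundDifferentialLin n) a A

theorem compoundMatrix_mul_conjTranspose {n : ℕ} {g : Matrix (Fin n) (Fin n) ℂ}
    (hg : g * g.conjTranspose = 1) :
    compoundMatrix g * (compoundMatrix g).conjTranspose = 1 := by
  rw [← compoundMatrix_conjTranspose, ← compoundMatrix_mul, hg, compoundMatrix_one]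

theorem compound_conj_unitary {n : ℕ} {g : Matrix (Fin n) (Fin n) ℂ}
    (hg : g * g.conjTranspose = 1) (A : Matrix (Fin n) (Fin n) ℂ) :
    compoundMatrix g * compoundDifferential A * (compoundMatrix g).conjTranspose =
      compoundDifferential (g * A * g.conjTranspose) := by
  rw [← compoundMatrix_conjTranspose, compound_conj hg]

/-- The abstracted gradient of the compound ansatz in terms of `n × n` matrices. -/
theorem abstractedGradient_compound {n : ℕ} {g₁ g₂ : Matrix (Fin n) (Fin n) ℂ}
    (hg₁ : g₁ * g₁.conjTranspose = 1) (hg₂ : g₂ * g₂.conjTranspose = 1)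
    (h : Matrix (Fin n) (Fin n) ℂ) (c : Fin n → ℝ) (a : ℝ) (ρ : Matrix (Qubits n) (Qubits n) ℂ) :
    abstractedGradient (compoundDifferential h) (∑ i, (c i : ℂ) • sigmaZ i) ρ
      (compoundMatrix g₁) (compoundMatrix g₂) =
      -2 * (ρ * compoundDifferential (g₂ *
        lieConj h (Matrix.diagonal fun i => ((c i - a : ℝ) : ℂ)) g₁ * g₂.conjTranspose)).trace := by
  have hD : Matrix.diagonal (fun i => (c i : ℂ)) =
      Matrix.diagonal (fun i => ((c i - a : ℝ) : ℂ)) + (a : ℂ) • 1 := by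
    rw [← Matrix.diagonal_one, ← Matrix.diagonal_smul, Matrix.diagonal_add]
    congr 1
    funext i
    simp
  -- A scalar shift of the diagonal is fixed by conjugation and commutes with `h`, so the mean of
  -- the coefficients can be removed.
  have hlie : lieConj h (Matrix.diagonal fun i => (c i : ℂ)) g₁ =
      lieConj h (Matrix.diagonal fun i => ((c i - a : ℝ) : ℂ)) g₁ := by
    unfold lieConj
    rw [hD, mul_add, add_mul, Matrix.mul_smul, Matrix.smul_mul, mul_one, hg₁, mul_add, add_mul,
      Matrix.mul_smul, Matrix.smul_mul, mul_one, one_mul]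
    abel
  have hK : compoundMatrix g₁ * (∑ i, (c i : ℂ) • sigmaZ i) * (compoundMatrix g₁).conjTranspose =
      ((∑ i, c i : ℝ) : ℂ) • (1 : Matrix (Qubits n) (Qubits n) ℂ) - (2 : ℂ) •
        compoundDifferential (g₁ * Matrix.diagonal (fun i => (c i : ℂ)) * g₁.conjTranspose) := by
    rw [sum_smul_sigmaZ, mul_sub, sub_mul, Matrix.mul_smul, Matrix.smul_mul, mul_one,
      compoundMatrix_mul_conjTranspose hg₁, Matrix.mul_smul, Matrix.smul_mul,
      compound_conj_unitary hg₁]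
  unfold abstractedGradient
  rw [hK, ← hlie]
  have hbr : ∀ (x : ℂ) (P Q : Matrix (Qubits n) (Qubits n) ℂ),
      P * (x • 1 - (2 : ℂ) • Q) - (x • 1 - (2 : ℂ) • Q) * P = (-2 : ℂ) • (P * Q - Q * P) := by
    intro x P Q
    rw [mul_sub, sub_mul, Matrix.mul_smul, Matrix.smul_mul, mul_one, one_mul, Matrix.mul_smul,
      Matrix.smul_mul]
    module
  rw [hbr, ← compoundDifferential_lie, Matrix.mul_smul, Matrix.trace_smul, smul_eq_mul]
  congr 1
  rw [← compound_conj_unitary hg₂, mul_assoc, mul_assoc, Matrix.trace_mul_comm]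
  simp only [mul_assoc, lieConj]

/-! ### Transfer along `ε : 𝕜 → ℂ` and witnesses for the initial states. -/

section Transfer

variable {n : ℕ} {𝕜 : Type*} [RCLike 𝕜] (ε : 𝕜 →ₐ[ℝ] ℂ)

/-- The expectation of the represented one-body operators in a state, as a real functional. -/
noncomputable def oneBodyExpectation (ρ : Matrix (Qubits n) (Qubits n) ℂ) :
    Matrix (Fin n) (Fin n) 𝕜 →ₗ[ℝ] ℝ where
  toFun M := (ρ * compoundDifferential (M.map ε)).trace.re
  map_add' A B := by
    have : (A + B).map ε = A.map ε + B.map ε := Matrix.map_add ε (map_add ε) A B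
    rw [this, compoundDifferential_add, mul_add, Matrix.trace_add, Complex.add_re]
  map_smul' r A := by
    have : (r • A).map ε = (r : ℂ) • A.map ε := by
      ext i j
      have : ε (r : 𝕜) = (r : ℂ) := ε.commutes r
      rw [Matrix.map_apply, Matrix.smul_apply, RCLike.real_smul_eq_coe_mul, map_mul, this,
        Matrix.smul_apply, Matrix.map_apply, smul_eq_mul]
    rw [this, compoundDifferential_smul, Matrix.mul_smul, Matrix.trace_smul, smul_eq_mul,
      Complex.re_ofReal_mul]
    rfl

theorem spread_nonneg (c : Fin n → ℝ) : 0 ≤ spread c := Finset.sum_nonneg fun _ _ => sq_nonneg _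

theorem frobSq_diagonal (d : Fin n → ℝ) :
    frobSq (Matrix.diagonal fun i => (d i : 𝕜)) = ∑ i, d i ^ 2 := by
  unfold frobSq
  refine Finset.sum_congr rfl fun i _ => ?_
  rw [Finset.sum_eq_single i]
  · rw [Matrix.diagonal_apply_eq, RCLike.norm_ofReal, sq_abs]
  · intro j _ hj
    rw [Matrix.diagonal_apply_ne _ hj.symm, norm_zero, sq, zero_mul]
  · simp

theorem isHermitian_diagonal_ofReal (d : Fin n → ℝ) :
    (Matrix.diagonal fun i => (d i : 𝕜)).IsHermitian := by
  rw [Matrix.IsHermitian, Matrix.diagonal_conjTranspose]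
  congr 1
  funext i
  rw [Pi.star_apply, RCLike.star_def, RCLike.conj_ofReal]

/-- The lower bound on the gradient variance, given a one-body witness that the state is not
fixed by the ansatz. -/
theorem le_gradVar (hε : ∀ x, ε (star x) = star (ε x)) (hn : 2 ≤ n)
    {h S : Matrix (Fin n) (Fin n) 𝕜} (hh : h.conjTranspose = -h) (ht : h.trace = 0)
    (hS : S.IsHermitian) (hSt : S.trace = 0) (hS2 : frobSq S = 2) (c : Fin n → ℝ)
    (ρ : Matrix (Qubits n) (Qubits n) ℂ) (hρ : 1 / 4 ≤ oneBodyExpectation ε ρ S ^ 2) :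
    1 / 8 / (n : ℝ) ^ 3 * frobSq h * spread c ≤
      gradVar (fun g : Matrix.specialUnitaryGroup (Fin n) 𝕜 =>
        compoundMatrix ((g : Matrix (Fin n) (Fin n) 𝕜).map ε)) (compoundDifferential (h.map ε))
        (∑ i, (c i : ℂ) • sigmaZ i) ρ := by
  have : NeZero n := ⟨by omega⟩
  have hn0 : (n : ℝ) ≠ 0 := Nat.cast_ne_zero.2 (NeZero.ne n)
  obtain ⟨B, hB, hBt, hBL⟩ := exists_traceless_isHermitian_repr (oneBodyExpectation ε ρ)
  set a : ℝ := (∑ j, c j) / n with ha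
  set D : Matrix (Fin n) (Fin n) 𝕜 := Matrix.diagonal fun i => ((c i - a : ℝ) : 𝕜) with hD
  have hDH : D.IsHermitian := isHermitian_diagonal_ofReal _
  have hDt : D.trace = 0 := by
    rw [hD, Matrix.trace_diagonal, ← RCLike.ofReal_sum, Finset.sum_sub_distrib, Finset.sum_const,
      Finset.card_univ, Fintype.card_fin, nsmul_eq_mul, ha, mul_div_cancel₀ _ hn0, sub_self,
      RCLike.ofReal_zero]
  have hDs : frobSq D = spread c := frobSq_diagonal _
  have hconj : ∀ A : Matrix (Fin n) (Fin n) 𝕜, A.conjTranspose.map ε = (A.map ε).conjTranspose :=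
    fun A => by
      ext i j
      exact hε _
  have hmul : ∀ A A' : Matrix (Fin n) (Fin n) 𝕜, (A * A').map ε = A.map ε * A'.map ε :=
    fun A A' => Matrix.map_mul
  have hsub : ∀ A A' : Matrix (Fin n) (Fin n) 𝕜, (A - A').map ε = A.map ε - A'.map ε :=
    fun A A' => Matrix.map_sub ε (map_sub ε) A A'
  have hDm : D.map ε = Matrix.diagonal fun i => ((c i - a : ℝ) : ℂ) := by
    rw [hD, Matrix.diagonal_map (map_zero ε)]
    congr 1
    funext i
    exact ε.commutes (c i - a)
  have hunit : ∀ g : Matrix.specialUnitaryGroup (Fin n) 𝕜,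
      (g : Matrix (Fin n) (Fin n) 𝕜).map ε *
        ((g : Matrix (Fin n) (Fin n) 𝕜).map ε).conjTranspose = 1 := by
    intro g
    rw [← hconj, ← hmul, ← Matrix.star_eq_conjTranspose, Matrix.mem_unitaryGroup_iff.1
      (Matrix.mem_specialUnitaryGroup_iff.1 g.2).1, Matrix.map_one ε (map_zero ε) (map_one ε)]
  have key : ∀ g : Matrix.specialUnitaryGroup (Fin n) 𝕜 × Matrix.specialUnitaryGroup (Fin n) 𝕜,
      (abstractedGradient (compoundDifferential (h.map ε)) (∑ i, (c i : ℂ) • sigmaZ i) ρ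
        (compoundMatrix ((g.1 : Matrix (Fin n) (Fin n) 𝕜).map ε))
        (compoundMatrix ((g.2 : Matrix (Fin n) (Fin n) 𝕜).map ε))).re =
      -2 * adjointCoeff (lieConj h D (g.1 : Matrix _ _ 𝕜)) B (g.2 : Matrix _ _ 𝕜) := by
    intro g
    have hM : (lieConj h D (g.1 : Matrix _ _ 𝕜)).IsHermitian :=
      isHermitian_lie (isHermitian_conj hDH _) hh
    have hMt : ((g.2 : Matrix _ _ 𝕜) * lieConj h D (g.1 : Matrix _ _ 𝕜) *
        (g.2 : Matrix _ _ 𝕜).conjTranspose).trace = 0 := by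
      rw [Matrix.trace_mul_comm, ← mul_assoc, ← Matrix.star_eq_conjTranspose,
        Matrix.mem_unitaryGroup_iff'.1 (Matrix.mem_specialUnitaryGroup_iff.1 g.2.2).1, one_mul]
      exact trace_lie _ _
    rw [abstractedGradient_compound (hunit _) (hunit _) _ _ a, ← hDm, adjointCoeff,
      ← hBL _ (isHermitian_conj hM _) hMt]
    have : ((g.2 : Matrix (Fin n) (Fin n) 𝕜) * lieConj h D (g.1 : Matrix _ _ 𝕜) *
        (g.2 : Matrix _ _ 𝕜).conjTranspose).map ε =
        (g.2 : Matrix (Fin n) (Fin n) 𝕜).map ε *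
          lieConj (h.map ε) (D.map ε) ((g.1 : Matrix (Fin n) (Fin n) 𝕜).map ε) *
          ((g.2 : Matrix (Fin n) (Fin n) 𝕜).map ε).conjTranspose := by
      simp only [lieConj, hmul, hsub, hconj]
    rw [oneBodyExpectation, LinearMap.coe_mk, AddHom.coe_mk, this]
    simp
  unfold gradVar
  simp only [key]
  refine le_trans ?_ (le_variance_adjointCoeff hn hDH hDt hB hBt hh ht)
  -- Cauchy–Schwarz against the witness: `1/4 ≤ (Re Tr(S B))² ≤ 2 ‖B‖²`.
  have hB8 : 1 / 8 ≤ frobSq B := by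
    have h1 := sq_re_trace_mul_le S B
    rw [← hBL S hS hSt, hS2] at h1
    linarith
  rw [hDs]
  have hc := spread_nonneg c
  have hf := frobSq_nonneg h
  have hn2 : (2 : ℝ) ≤ n := by exact_mod_cast hn
  -- Amounts to `(n + 1)² ≤ 4n²`.
  have hrat : 1 / 8 / (n : ℝ) ^ 3 ≤ 4 * (1 / (n * (n + 1))) ^ 2 * n * (1 / 8) := by
    rw [div_div, div_pow, mul_pow, one_pow, div_le_iff₀ (by positivity)]
    have : 4 * (1 / ((n : ℝ) ^ 2 * (n + 1) ^ 2)) * n * (1 / 8) * (8 * n ^ 3) =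
        4 * n ^ 2 / (n + 1) ^ 2 := by
      field_simp
    rw [this, le_div_iff₀ (by positivity)]
    nlinarith
  calc 1 / 8 / (n : ℝ) ^ 3 * frobSq h * spread c
      ≤ 4 * (1 / (n * (n + 1))) ^ 2 * n * (1 / 8) * frobSq h * spread c := by gcongr
    _ ≤ 4 * (1 / (n * (n + 1))) ^ 2 * n * frobSq B * frobSq h * spread c := by gcongr
    _ = _ := by ring

theorem trace_pureState_mul {ι : Type*} [Fintype ι] (ψ : ι → ℂ) (A : Matrix ι ι ℂ) :
    (pureState ψ * A).trace = ∑ s, ∑ t, ψ s * star (ψ t) * A t s := by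
  simp [pureState, Matrix.trace, Matrix.mul_apply, Matrix.vecMulVec_apply]

/-- Every initial state has a one-body witness. -/
theorem exists_witness (hn : 2 ≤ n) {ψ : Qubits n → ℂ} (hψ : IsInitialKet ψ) :
    ∃ S : Matrix (Fin n) (Fin n) 𝕜, S.IsHermitian ∧ S.trace = 0 ∧ frobSq S = 2 ∧
      1 / 4 ≤ oneBodyExpectation ε (pureState ψ) S ^ 2 := by
  rcases hψ with ⟨s, ⟨i, j, hij⟩, rfl⟩ | rfl
  · obtain ⟨i, j, hi, hj⟩ : ∃ i j, s i = 1 ∧ s j = 0 := by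
      by_cases hi : s i = 1
      · exact ⟨i, j, hi, by omega⟩
      · exact ⟨j, i, by omega, by omega⟩
    have hne : i ≠ j := by
      rintro rfl
      rw [hi] at hj
      exact absurd hj (by decide)
    -- The witness is `E_ii - E_jj`, with `i` occupied and `j` empty; its expectation is the
    -- difference of the occupation numbers, `1`. Such a pair exists because the string is not
    -- constant.
    let d : Fin n → ℝ := fun k => (if k = i then 1 else 0) - if k = j then 1 else 0
    refine ⟨Matrix.diagonal fun k => (d k : 𝕜), isHermitian_diagonal_ofReal _, ?_, ?_, ?_⟩
    · rw [Matrix.trace_diagonal, ← RCLike.ofReal_sum]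
      simp [d]
    · rw [frobSq_diagonal]
      have : ∀ k, d k ^ 2 = (if k = i then 1 else 0) + if k = j then 1 else 0 := by
        intro k
        simp only [d]
        split_ifs with h1 h2
        · exact absurd (h1.symm.trans h2) hne
        all_goals norm_num
      simp only [this, Finset.sum_add_distrib, Finset.sum_ite_eq', Finset.mem_univ, if_true]
      norm_num
    · have hm : (Matrix.diagonal fun k => (d k : 𝕜)).map ε = Matrix.diagonal fun k => (d k : ℂ) := by
        rw [Matrix.diagonal_map (map_zero ε)]
        congr 1
        funext k
        exact ε.commutes (d k)
      have hv : oneBodyExpectation ε (pureState (basisKet s))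
          (Matrix.diagonal fun k => (d k : 𝕜)) = 1 := by
        rw [oneBodyExpectation, LinearMap.coe_mk, AddHom.coe_mk, hm, compoundDifferential_diagonal,
          trace_pureState_mul]
        rw [Finset.sum_eq_single s (fun t _ ht => by simp [basisKet, ht]) (by simp),
          Finset.sum_eq_single s (fun t _ ht => by simp [basisKet, ht]) (by simp)]
        rw [Matrix.diagonal_apply_eq, ← Complex.ofReal_sum]
        simp [basisKet, d, mem_occupied, hi, hj]
      rw [hv]
      norm_num
  · obtain ⟨m, rfl⟩ := Nat.exists_eq_add_of_le' hn
    have ht : (symUnit 𝕜 (0 : Fin (m + 2)) 1).trace = 0 := by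
      simp [symUnit, Matrix.trace_add, Matrix.trace_single_eq_of_ne]
    -- In the uniform superposition the hop between modes `0` and `1` has expectation `2 · 2^m /
    -- 2^(m+2) = 1/2`, the source of the threshold `1/4`.
    refine ⟨symUnit 𝕜 0 1, isHermitian_symUnit _ _, ht, ?_, ?_⟩
    · rw [frobSq_eq_trace, (isHermitian_symUnit _ _).eq, trace_mul_symUnit]
      simp [symUnit]
      norm_num
    · have hm : (symUnit 𝕜 (0 : Fin (m + 2)) 1).map ε =
          Matrix.single 0 1 1 + Matrix.single 1 0 1 := by
        rw [symUnit, Matrix.map_add ε (map_add ε), Matrix.map_single, Matrix.map_single, map_one]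
      have hv : oneBodyExpectation ε (pureState (plusKet (m + 2)))
          (symUnit 𝕜 (0 : Fin (m + 2)) 1) = 1 / 2 := by
        rw [oneBodyExpectation, LinearMap.coe_mk, AddHom.coe_mk, hm, trace_pureState_mul]
        have hp : ∀ s t : Qubits (m + 2), plusKet (m + 2) s * star (plusKet (m + 2) t) =
            ((1 / 2 ^ (m + 2) : ℝ) : ℂ) := by
          intro s t
          simp only [plusKet]
          rw [Complex.star_def, Complex.conj_ofReal, ← Complex.ofReal_mul]
          congr 1
          rw [div_mul_div_comm, Real.mul_self_sqrt (by positivity), one_mul]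
        simp only [hp, ← Finset.mul_sum]
        rw [Finset.sum_comm, sum_compoundDifferential_hop, Complex.re_ofReal_mul]
        have : ((2 : ℂ) * 2 ^ m) = ((2 * 2 ^ m : ℝ) : ℂ) := by push_cast; rfl
        rw [this, Complex.ofReal_re]
        field_simp
        ring
      rw [hv]
      norm_num

end Transfer

/-! ### The two groups, the generators and the constants. -/

theorem stdNormSq_eq_frobSq {n : ℕ} {h : Matrix (Fin n) (Fin n) ℂ} (hh : h.conjTranspose = -h) :
    stdNormSq h = frobSq h := by
  rw [frobSq_eq_trace, hh, stdNormSq, mul_neg, Matrix.trace_neg]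
  rfl

theorem le_gradVar_compoundSU {n : ℕ} (hn : 2 ≤ n) {ψ : Qubits n → ℂ} (hψ : IsInitialKet ψ)
    {h : Matrix (Fin n) (Fin n) ℂ} (hh : h ∈ suSet n) (c : Fin n → ℝ) :
    1 / 8 / (n : ℝ) ^ 3 * stdNormSq h * spread c ≤
      gradVar compoundSU (compoundDifferential h) (∑ i, (c i : ℂ) • sigmaZ i) (pureState ψ) := by
  obtain ⟨S, hS, hSt, hS2, hw⟩ := exists_witness (AlgHom.id ℝ ℂ) hn hψ
  rw [stdNormSq_eq_frobSq hh.1]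
  have := le_gradVar (AlgHom.id ℝ ℂ) (fun _ => rfl) hn hh.1 hh.2 hS hSt hS2 c _ hw
  simp only [AlgHom.coe_id, Matrix.map_id] at this
  exact this

theorem le_gradVar_compoundSO {n : ℕ} (hn : 2 ≤ n) {ψ : Qubits n → ℂ} (hψ : IsInitialKet ψ)
    {h : Matrix (Fin n) (Fin n) ℂ} (hh : h ∈ soSet n) (c : Fin n → ℝ) :
    1 / 8 / (n : ℝ) ^ 3 * stdNormSq h * spread c ≤
      gradVar compoundSO (compoundDifferential h) (∑ i, (c i : ℂ) • sigmaZ i) (pureState ψ) := by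
  obtain ⟨S, hS, hSt, hS2, hw⟩ := exists_witness (𝕜 := ℝ) Complex.ofRealAm hn hψ
  have hmap : (h.map Complex.re).map Complex.ofRealAm = h := by
    ext i j
    refine Complex.ext ?_ ?_
    · simp
    · simp [hh.2 i j]
  have hfrob : frobSq (h.map Complex.re) = frobSq h := by
    conv_rhs => rw [← hmap]
    simp [frobSq]
  have hskew : (h.map Complex.re).conjTranspose = -h.map Complex.re := by
    ext i j
    have := congrArg Complex.re (congrFun (congrFun hh.1.1 i) j)
    simpa using this
  have htr : (h.map Complex.re).trace = 0 := by
    have := congrArg Complex.re hh.1.2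
    simpa [Matrix.trace] using this
  rw [stdNormSq_eq_frobSq hh.1.1, ← hfrob]
  have := le_gradVar Complex.ofRealAm (fun x => (Complex.conj_ofReal x).symm) hn hskew htr hS hSt
    hS2 c _ hw
  rw [hmap] at this
  exact this

theorem spread_single {n : ℕ} (hn : 2 ≤ n) (i : Fin n) :
    1 / 2 ≤ spread (Pi.single i (1 : ℝ)) := by
  have hn2 : (2 : ℝ) ≤ n := by exact_mod_cast hn
  have h1 : ∀ k, ((Pi.single i (1 : ℝ) : Fin n → ℝ) k - 1 / n) ^ 2 =
      (if k = i then 1 - 2 / (n : ℝ) else 0) + 1 / (n : ℝ) ^ 2 := by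
    intro k
    rw [Pi.single_apply]
    split_ifs
    · field_simp
      ring
    · field_simp
      ring
  unfold spread
  rw [Finset.sum_pi_single' i (1 : ℝ) Finset.univ, if_pos (Finset.mem_univ _)]
  simp only [h1, Finset.sum_add_distrib, Finset.sum_ite_eq', Finset.mem_univ, if_true,
    Finset.sum_const, Finset.card_univ, Fintype.card_fin, nsmul_eq_mul]
  have : 1 - 2 / (n : ℝ) + n * (1 / (n : ℝ) ^ 2) = 1 - 1 / n := by
    field_simp
    ring
  rw [this]
  have : 1 / (n : ℝ) ≤ 1 / 2 := one_div_le_one_div_of_le (by norm_num) hn2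
  linarith

theorem sum_single_smul_sigmaZ {n : ℕ} (i : Fin n) :
    ∑ k, ((Pi.single i (1 : ℝ) : Fin n → ℝ) k : ℂ) • sigmaZ k = sigmaZ i := by
  rw [Finset.sum_eq_single i]
  · simp
  · intro k _ hk
    simp [hk]
  · simp

theorem stdNormSq_generator {n : ℕ} {P : Matrix (Fin n) (Fin n) ℂ} (hP : (P * P).trace = 2) :
    stdNormSq ((-(Complex.I / 2)) • P) = 1 / 2 := by
  rw [stdNormSq, smul_mul_smul_comm, Matrix.trace_smul, hP, smul_eq_mul]
  have : -(Complex.I / 2) * -(Complex.I / 2) * 2 = ((-1 / 2 : ℝ) : ℂ) := by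
    push_cast
    linear_combination (1 / 2) * Complex.I_mul_I
  rw [this]
  norm_num

theorem generator_mem_suSet {n : ℕ} {P : Matrix (Fin n) (Fin n) ℂ} (hP : P.IsHermitian)
    (ht : P.trace = 0) : (-(Complex.I / 2)) • P ∈ suSet n := by
  refine ⟨?_, by rw [Matrix.trace_smul, ht, smul_zero]⟩
  rw [Matrix.conjTranspose_smul, hP.eq, ← neg_smul]
  congr 1
  simp [neg_div]

theorem suGenerators_spec {n : ℕ} {h : Matrix (Fin n) (Fin n) ℂ} (hh : h ∈ suGenerators n) :
    h ∈ suSet n ∧ stdNormSq h = 1 / 2 := by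
  obtain ⟨i, j, hij, rfl | rfl | rfl⟩ := hh
  · refine ⟨generator_mem_suSet ?_ ?_, stdNormSq_generator ?_⟩
    · simp [Matrix.IsHermitian, pauliX, add_comm]
    · simp [pauliX, Matrix.trace_add, Matrix.trace_single_eq_of_ne, hij, hij.symm]
    · simp [pauliX, mul_add, add_mul, hij, hij.symm, Matrix.trace_add]
      norm_num
  · refine ⟨generator_mem_suSet ?_ ?_, stdNormSq_generator ?_⟩
    · simp [Matrix.IsHermitian, pauliY, add_comm]
    · simp [pauliY, Matrix.trace_add, Matrix.trace_single_eq_of_ne, hij, hij.symm]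
    · simp [pauliY, mul_add, add_mul, hij, hij.symm, Matrix.trace_add]
      norm_num
  · refine ⟨generator_mem_suSet ?_ ?_, stdNormSq_generator ?_⟩
    · simp [Matrix.IsHermitian, pauliZ]
    · simp [pauliZ, Matrix.trace_sub]
    · simp [pauliZ, mul_sub, sub_mul, hij, hij.symm]
      norm_num

theorem soGenerators_spec {n : ℕ} {h : Matrix (Fin n) (Fin n) ℂ} (hh : h ∈ soGenerators n) :
    h ∈ soSet n ∧ stdNormSq h = 1 / 2 := by
  obtain ⟨i, j, hij, rfl⟩ := hh
  obtain ⟨h1, h2⟩ := suGenerators_spec ⟨i, j, hij, Or.inr (Or.inl rfl)⟩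
  refine ⟨⟨h1, fun k l => ?_⟩, h2⟩
  simp only [pauliY, Matrix.smul_apply, Matrix.add_apply, Matrix.single_apply]
  split_ifs <;> simp

/-- The constant `1/32` is `1/8` times the squared norm `1/2` of a generator times the lower bound
`1/2` for the spread `1 - 1/n` of a single coefficient. -/
theorem generator_bound {n : ℕ} (hn : 2 ≤ n) {v : ℝ} (i : Fin n)
    (hv : 1 / 8 / (n : ℝ) ^ 3 * (1 / 2) * spread (Pi.single i (1 : ℝ)) ≤ v) :
    1 / 32 / (n : ℝ) ^ 3 ≤ v := by
  refine le_trans ?_ hv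
  calc 1 / 32 / (n : ℝ) ^ 3 = 1 / 8 / (n : ℝ) ^ 3 * (1 / 2) * (1 / 2) := by ring
    _ ≤ _ := by
      have := spread_single hn i
      gcongr

theorem combination_bound {n : ℕ} {h : Matrix (Fin n) (Fin n) ℂ} (hh : h ∈ suSet n)
    (c : Fin n → ℝ) {v : ℝ} (hv : 1 / 8 / (n : ℝ) ^ 3 * stdNormSq h * spread c ≤ v) :
    1 / 32 / (n : ℝ) ^ 3 * stdNormSq h * spread c ≤ v := by
  refine le_trans ?_ hv
  have h1 : 0 ≤ stdNormSq h := by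
    rw [stdNormSq_eq_frobSq hh.1]
    exact frobSq_nonneg h
  have h2 := spread_nonneg c
  gcongr
  norm_num

theorem corollary1 :
    (∀ (n : ℕ) (i : Fin n),
      Complex.I • sigmaZ i ∉ compoundDLA (suGenerators n) ∧
      Complex.I • sigmaZ i ∉ compoundDLA (soGenerators n)) ∧
    ∃ C : ℝ, 0 < C ∧ ∃ d : ℕ, ∀ n : ℕ, 2 ≤ n →
      ∀ ψ : Qubits n → ℂ, IsInitialKet ψ →
        -- a single `σ_z` as observable and a generator of the ansatz
        (∀ h ∈ suGenerators n, ∀ i : Fin n,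
          C / (n : ℝ) ^ d ≤
            gradVar compoundSU (compoundDifferential h) (sigmaZ i) (pureState ψ)) ∧
        (∀ h ∈ soGenerators n, ∀ i : Fin n,
          C / (n : ℝ) ^ d ≤
            gradVar compoundSO (compoundDifferential h) (sigmaZ i) (pureState ψ)) ∧
        -- a real combination of `σ_z`'s as observable and any element of the Lie algebra
        (∀ h ∈ suSet n, ∀ c : Fin n → ℝ,
          C / (n : ℝ) ^ d * stdNormSq h * spread c ≤
            gradVar compoundSU (compoundDifferential h)
              (∑ i, (c i : ℂ) • sigmaZ i) (pureState ψ)) ∧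
        (∀ h ∈ soSet n, ∀ c : Fin n → ℝ,
          C / (n : ℝ) ^ d * stdNormSq h * spread c ≤
            gradVar compoundSO (compoundDifferential h)
              (∑ i, (c i : ℂ) • sigmaZ i) (pureState ψ)) := by

  refine ⟨fun n i => ⟨I_smul_sigmaZ_notMem_compoundDLA _ i, I_smul_sigmaZ_notMem_compoundDLA _ i⟩,
    1 / 32, by norm_num, 3, fun n hn ψ hψ => ⟨fun h hh i => ?_, fun h hh i => ?_,
      fun h hh c => combination_bound hh c (le_gradVar_compoundSU hn hψ hh c),
      fun h hh c => combination_bound hh.1 c (le_gradVar_compoundSO hn hψ hh c)⟩⟩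
  · obtain ⟨h1, h2⟩ := suGenerators_spec hh
    have := le_gradVar_compoundSU hn hψ h1 (Pi.single i 1)
    rw [h2, sum_single_smul_sigmaZ] at this
    exact generator_bound hn i this
  · obtain ⟨h1, h2⟩ := soGenerators_spec hh
    have := le_gradVar_compoundSO hn hψ h1 (Pi.single i 1)
    rw [h2, sum_single_smul_sigmaZ] at this
    exact generator_bound hn i this
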